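/- Let $m\ge 1$, let $V$ be a real vector space of dimension $2m$ with a symplectic form $\sigma$, and let $\Lambda:\mathbb R\to\mathbb P V\cong\mathbb P^{2m-1}$ be a smooth parametrized curve. A lift of $\Lambda$ is a smooth nowhere vanishing map $E$ to $V$ with $E(t)\in\Lambda(t)$. Suppose that $\Lambda$ is regular (for every lift $E$ and every $t$, the vectors $E(t),E'(t),\dots,E^{(2m-1)}(t)$ span $V$) and self-dual (for every lift $E$ and every $t$, $\operatorname{span}\{E(t),\dots,E^{(m-1)}(t)\}$ is Lagrangian). A lift $E$ of a regular parametrized curve is called a canonical section if $E^{(2m)}=\sum_{i=0}^{2m-2}B_i\,E^{(i)}$ for some functions $B_i$, and strongly canonical if moreover $|\sigma(E^{(m)},E^{(m-1)})|\equiv 1$. The symplectic curvatures of $\Lambda$ are the functions $\rho_1,\dots,\rho_m$ such that, for a strongly canonical section $E$, $$E^{(2m)}=\sum_{i=1}^m(-1)^{i+1}\frac{d^{m-i}}{dt^{m-i}}\Bigl(\rho_i\,\frac{d^{m-i}}{dt^{m-i}}E\Bigr).$$ A parameter $t$ on a piece of the curve (obtained by a smooth change of the original parameter with nowhere vanishing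 derivative, on an open interval) is called projective if the coefficient $B_{2m-2}$ of a canonical section with respect to $t$ vanishes identically. For $1\le i\le 2m-2$ the $i$-th Wilczynski invariant of the curve is the form $$\mathcal W_i=\frac{(i+1)!}{(2i+2)!}\left(\sum_{j=1}^{i}(-1)^{j-1}\frac{(2i-j+3)!\,(2m-i+j-3)!}{(i+2-j)!\,(j-1)!}\,B_{2m-3-i+j}^{(j-1)}(t)\right)(dt)^{i+2},$$ where $t$ is a projective parameter and the $B_k$ are the coefficients of a canonical section with respect to $t$. Suppose that the symplectic curvatures of $\Lambda$ are constant, $\rho_i\equiv r_i\in\mathbb R$ for $1\le i\le m$, so that $\Lambda=\Lambda_{(r_1,\dots,r_m)}$. Then all Wilczynski invariants of $\Lambda$ are zero (in every projective parameter on every piece of the curve) if and only if the tuple $(r_1,\dots,r_m)$ is exceptional, i.e. the $2m$ complex roots, counted with multiplicity, of $$\lambda^{2m}+\sum_{i=1}^m(-1)^i r_i\,\lambda^{2(m-i)}$$ form an arithmetic progression (possibly with common difference $0$). -/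

import Mathlib

open scoped Nat ContDiff

namespace SelfDualCurve

variable {V : Type*} [NormedAddCommGroup V] [NormedSpace ℝ V]

/-- `E` is a smooth nowhere vanishing section, over the parameter interval `I`, of the
tautological line bundle of the parametrized curve `Λ` in the projective space of `V`. -/
structure IsLift (Λ : ℝ → Projectivization ℝ V) (I : Set ℝ) (E : ℝ → V) : Prop where
  contDiffOn : ContDiffOn ℝ ∞ E I
  ne_zero : ∀ t ∈ I, E t ≠ 0
  mem : ∀ t ∈ I, E t ∈ (Λ t).submodule

/-- The span of `E t, E' t, …, E^(i) t`. When `E` is a lift of a curve, this is the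
`i`-th osculating space of the curve at the parameter `t`. -/
def osculatingSpace (E : ℝ → V) (i : ℕ) (t : ℝ) : Submodule ℝ V :=
  Submodule.span ℝ (Set.range fun j : Fin (i + 1) => iteratedDeriv (j : ℕ) E t)

/-- A smooth regular (convex) curve, parametrized by `I`, in the projectivization of the
`2m`-dimensional space `V`: there is a smooth lift, and every lift has derivatives of order
`0, …, 2m - 1` spanning `V`. -/
structure IsRegularCurve (m : ℕ) (Λ : ℝ → Projectivization ℝ V) (I : Set ℝ) : Prop where
  exists_lift : ∃ E : ℝ → V, IsLift Λ I E
  span_eq_top : ∀ E : ℝ → V, IsLift Λ I E → ∀ t ∈ I, osculatingSpace E (2 * m - 1) t = ⊤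

/-- Self-duality with respect to the symplectic form `σ`: every `(m - 1)`-th osculating space
is Lagrangian, i.e. equal to its skew-orthogonal complement. -/
def IsSelfDualCurve (m : ℕ) (σ : LinearMap.BilinForm ℝ V) (Λ : ℝ → Projectivization ℝ V)
    (I : Set ℝ) : Prop :=
  ∀ E : ℝ → V, IsLift Λ I E → ∀ t ∈ I,
    σ.orthogonal (osculatingSpace E (m - 1) t) = osculatingSpace E (m - 1) t

/-- `E` is a canonical section of the curve `Λ` with respect to its parameter, with
coefficients `B 0, …, B (2m - 2)`:  `E^(2m) = ∑_{i=0}^{2m-2} B_i E^(i)` on `I`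
(there is no term with `E^(2m-1)`). -/
structure IsCanonicalSection (m : ℕ) (Λ : ℝ → Projectivization ℝ V) (I : Set ℝ)
    (E : ℝ → V) (B : ℕ → ℝ → ℝ) : Prop where
  isLift : IsLift Λ I E
  expansion : ∀ t ∈ I, iteratedDeriv (2 * m) E t =
    ∑ i ∈ Finset.range (2 * m - 1), B i t • iteratedDeriv i E t

/-- `E` is a strongly canonical section: a canonical section with
`|σ (E^(m), E^(m-1))| = 1` identically. -/
def IsStronglyCanonicalSection (m : ℕ) (σ : LinearMap.BilinForm ℝ V)
    (Λ : ℝ → Projectivization ℝ V) (I : Set ℝ) (E : ℝ → V) : Prop :=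
  (∃ B : ℕ → ℝ → ℝ, IsCanonicalSection m Λ I E B) ∧
    ∀ t ∈ I, |σ (iteratedDeriv m E t) (iteratedDeriv (m - 1) E t)| = 1

/-- The smooth functions `ρ 0, …, ρ (m - 1)` are the first, …, `m`-th symplectic curvatures of
the parametrized curve `Λ`: for a strongly canonical section `E`,
`E^(2m) = ∑_{i=1}^{m} (-1)^(i+1) (d/dt)^(m-i) (ρ_i (d/dt)^(m-i) E)`.
The `i`-th curvature is `ρ (i - 1)`. -/
def HasSymplecticCurvatures (m : ℕ) (σ : LinearMap.BilinForm ℝ V)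
    (Λ : ℝ → Projectivization ℝ V) (I : Set ℝ) (ρ : Fin m → ℝ → ℝ) : Prop :=
  (∀ k, ContDiffOn ℝ ∞ (ρ k) I) ∧
  ∃ E : ℝ → V, IsStronglyCanonicalSection m σ Λ I E ∧
    ∀ t ∈ I, iteratedDeriv (2 * m) E t =
      ∑ k : Fin m, (-1 : ℝ) ^ ((k : ℕ) + 2) •
        iteratedDeriv (m - ((k : ℕ) + 1))
          (fun s => ρ k s • iteratedDeriv (m - ((k : ℕ) + 1)) E s) t

/-- `υ` is a local change of parameter from the open interval `J` into `I`: smooth, with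
nowhere vanishing derivative. The reparametrized curve is `Λ ∘ υ`. -/
structure IsReparametrization (I J : Set ℝ) (υ : ℝ → ℝ) : Prop where
  isOpen : IsOpen J
  ordConnected : J.OrdConnected
  mapsTo : Set.MapsTo υ J I
  contDiffOn : ContDiffOn ℝ ∞ υ J
  deriv_ne_zero : ∀ t ∈ J, deriv υ t ≠ 0

/-- The change of parameter `υ` leads to a projective parameter on the curve `Λ`, `E` is a
canonical section with respect to this parameter, and `B` are its coefficients:
a parameter is projective when `B (2m - 2)` vanishes identically. -/
structure IsProjectiveParameter (m : ℕ) (Λ : ℝ → Projectivization ℝ V) (I J : Set ℝ)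
    (υ : ℝ → ℝ) (E : ℝ → V) (B : ℕ → ℝ → ℝ) : Prop where
  isReparametrization : IsReparametrization I J υ
  isCanonicalSection : IsCanonicalSection m (Λ ∘ υ) J E B
  coeff_eq_zero : ∀ t ∈ J, B (2 * m - 2) t = 0

/-- The coefficient of `(dt)^(i+2)` in the `i`-th Wilczynski invariant, `1 ≤ i ≤ 2m - 2`,
in terms of the coefficients `B` of a canonical section in a projective parameter `t`. -/
noncomputable def wilczynski (m : ℕ) (B : ℕ → ℝ → ℝ) (i : ℕ) (t : ℝ) : ℝ :=
  ((i + 1)! : ℝ) / ((2 * i + 2)! : ℝ) *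
    ∑ j ∈ Finset.Icc 1 i, (-1 : ℝ) ^ (j - 1) *
      (((2 * i + 3 - j)! : ℝ) * ((2 * m + j - (i + 3))! : ℝ) /
        (((i + 2 - j)! : ℝ) * ((j - 1)! : ℝ))) *
      iteratedDeriv (j - 1) (B (2 * m + j - (i + 3))) t

/-- All Wilczynski invariants of the curve `Λ` (parametrized by `I`) are zero: their
expressions in every projective parameter, defined on any piece of the curve, vanish. -/
def AllWilczynskiInvariantsZero (m : ℕ) (Λ : ℝ → Projectivization ℝ V) (I : Set ℝ) : Prop :=
  ∀ (J : Set ℝ) (υ : ℝ → ℝ) (E : ℝ → V) (B : ℕ → ℝ → ℝ),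
    IsProjectiveParameter m Λ I J υ E B →
      ∀ i ∈ Finset.Icc 1 (2 * m - 2), ∀ t ∈ J, wilczynski m B i t = 0

/-- The polynomial `λ^(2m) + ∑_{i=1}^{m} (-1)^i r_i λ^(2(m-i))` over `ℂ`;
the number `r_i` is `r (i - 1)`. -/
noncomputable def charPoly (m : ℕ) (r : Fin m → ℝ) : Polynomial ℂ :=
  Polynomial.X ^ (2 * m) +
    ∑ k : Fin m, Polynomial.C ((-1 : ℂ) ^ ((k : ℕ) + 1) * (r k : ℂ)) *
      Polynomial.X ^ (2 * (m - ((k : ℕ) + 1)))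

/-- The tuple `r` is exceptional: the `2m` complex roots of `charPoly`, with multiplicities,
are the terms `a, a + d, …, a + (2m - 1) d` of an arithmetic progression. -/
def IsExceptional (m : ℕ) (r : Fin m → ℝ) : Prop :=
  ∃ a d : ℂ, (charPoly m r).roots = (Multiset.range (2 * m)).map fun k : ℕ => a + (k : ℂ) * d

end SelfDualCurve

/-!
Write `n = 2m` and `N = n - 1`. The Wilczynski forms are triangular in the coefficients of a
canonical section in a projective parameter, so they all vanish iff `G^(n) = 0` for that section
`G` (`coeff_eq_zero_of_wilczynski`, `wilczynski_eq_zero`). On the other hand the strongly canonical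
section `E` satisfies `P(d/dt) E = 0`, where `P` is the constant-coefficient polynomial of the
statement, and `E, E', …, E^(N)` are linearly independent.

The bridge is the `N`-th symmetric power of the equation `y'' = κ y`, whose operator is
`K_n(d/dt)` for the polynomials `K_0 = 1`, `K_1 = X`, `K_{k+1} = X K_k - k (n - k) κ K_{k-1}`.
Over `ℂ`, if `κ = μ²`, then `K_n = ∏_{j ≤ N} (X - (2j - N) μ)` (`sylvesterKac_eq_prod`), so its
roots form an arithmetic progression. Since `P` is even, its roots form an arithmetic progression
iff `P = K_n` for the only `κ` that makes the coefficients of `X^(n-2)` agree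
(`isExceptional_iff`).

The operators are covariant under changes of parameter `υ`. If `w² υ'` is constant and
`F = w^N • E ∘ υ`, then the chain `u_0 = E`, `u_{k+1} = u_k' - k (n - k) κ u_{k-1}`, i.e.
`u_k = K_k(d/dt) E`, is carried to the analogous chain over `F`, with `κ` replaced by the potential
`w''/w + κ υ'²` and with last term a nonzero multiple of `(K_n(d/dt) E) ∘ υ`
(`IsKacChain.reparam`). In particular, if the potential vanishes, then
`F^(n) = w^N υ'^n • (K_n(d/dt) E) ∘ υ`.

If all invariants vanish, apply this to the parameter `υ' = 1/(1 - κ t²)`, for which the potential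
is zero: `F` is canonical there, hence `F^(n) = 0`, hence `K_n(d/dt) E` vanishes at a point, and
`P - K_n`, of degree less than `n - 2`, is zero by linear independence. Conversely, let `P = K_n`
and let `G` be a canonical section in a projective parameter. Comparing the terms in `F^(n-1)`
shows that `G` is a locally constant multiple of `F`; comparing those in `F^(n-2)` shows that the
potential is zero; therefore `G^(n) = 0`.
-/

namespace SelfDualCurve

open Polynomial

/-! ### Sylvester–Kac polynomials and the algebraic form of exceptionality -/

section

section Algebra

/-- The Sylvester–Kac polynomials: `K_0 = 1`, `K_1 = X` and
`K_{k+1} = X K_k - k (N + 1 - k) κ K_{k-1}`. For `k = N + 1` this is the characteristic polynomial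
of the `N`-th symmetric power of the differential equation `y'' = κ y`. -/
noncomputable def sylvesterKac {R : Type*} [CommRing R] (N : ℕ) (κ : R) : ℕ → R[X]
  | 0 => 1
  | 1 => X
  | k + 2 => X * sylvesterKac N κ (k + 1) -
      C (((k : R) + 1) * ((N : R) - k) * κ) * sylvesterKac N κ k

/-- The sum `∑_{i < k} i (N + 1 - i)`; `-κ` times it is the coefficient of `X^(k-2)` in the
`k`-th Sylvester–Kac polynomial. -/
noncomputable def sylvesterKacConst (R : Type*) [CommRing R] (N k : ℕ) : R :=
  ∑ i ∈ Finset.range k, (i : R) * ((N : R) + 1 - i)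

variable {R : Type*} [CommRing R] (N : ℕ) (κ : R)

lemma sylvesterKac_add_two (k : ℕ) : sylvesterKac N κ (k + 2) = X * sylvesterKac N κ (k + 1) -
      C (((k : R) + 1) * ((N : R) - k) * κ) * sylvesterKac N κ k := rfl

lemma coeff_sylvesterKac_of_lt (k j : ℕ) (h : k < j) : (sylvesterKac N κ k).coeff j = 0 := by
  induction k using Nat.twoStepInduction generalizing j with
  | zero => simp [sylvesterKac, coeff_one, h.ne']
  | one => simp [sylvesterKac, coeff_X, h.ne]
  | more k ih1 ih2 =>
    obtain ⟨j, rfl⟩ : ∃ i, j = i + 1 := ⟨j - 1, by lia⟩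
    rw [sylvesterKac_add_two, coeff_sub, coeff_X_mul, coeff_C_mul, ih1 _ (by lia), ih2 _ (by lia)]
    simp

lemma coeff_sylvesterKac_self (k : ℕ) : (sylvesterKac N κ k).coeff k = 1 := by
  induction k using Nat.twoStepInduction with
  | zero => simp [sylvesterKac]
  | one => simp [sylvesterKac]
  | more k ih1 ih2 =>
    rw [sylvesterKac_add_two, coeff_sub, coeff_X_mul, coeff_C_mul, ih2,
      coeff_sylvesterKac_of_lt _ _ _ _ (by lia)]
    simp

lemma coeff_sylvesterKac_succ (k : ℕ) : (sylvesterKac N κ (k + 1)).coeff k = 0 := by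
  induction k with
  | zero => simp [sylvesterKac]
  | succ k ih =>
    rw [sylvesterKac_add_two, coeff_sub, coeff_X_mul, coeff_C_mul, ih,
      coeff_sylvesterKac_of_lt _ _ _ _ (by lia)]
    simp

lemma coeff_sylvesterKac_add_two (k : ℕ) :
    (sylvesterKac N κ (k + 2)).coeff k = -(sylvesterKacConst R N (k + 2) * κ) := by
  induction k with
  | zero => simp [sylvesterKac, sylvesterKacConst, Finset.sum_range_succ]
  | succ k ih =>
    rw [sylvesterKac_add_two, coeff_sub, coeff_X_mul, coeff_C_mul, ih, coeff_sylvesterKac_self,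
      sylvesterKacConst, sylvesterKacConst, Finset.sum_range_succ _ (k + 2)]
    push_cast
    ring

lemma monic_sylvesterKac (k : ℕ) : (sylvesterKac N κ k).Monic :=
  monic_of_natDegree_le_of_coeff_eq_one k
    (natDegree_le_iff_coeff_eq_zero.2 fun j hj => coeff_sylvesterKac_of_lt N κ k j hj)
    (coeff_sylvesterKac_self N κ k)

lemma natDegree_sylvesterKac [Nontrivial R] (k : ℕ) : (sylvesterKac N κ k).natDegree = k :=
  le_antisymm
    (natDegree_le_iff_coeff_eq_zero.2 fun j hj => coeff_sylvesterKac_of_lt N κ k j hj)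
    (le_natDegree_of_ne_zero (by simp [coeff_sylvesterKac_self]))

lemma map_sylvesterKac {S : Type*} [CommRing S] (f : R →+* S) (k : ℕ) :
    (sylvesterKac N κ k).map f = sylvesterKac N (f κ) k := by
  induction k using Nat.twoStepInduction with
  | zero => simp [sylvesterKac]
  | one => simp [sylvesterKac]
  | more k ih1 ih2 => simp [sylvesterKac_add_two, ih1, ih2]

lemma sylvesterKac_zero_right (k : ℕ) : sylvesterKac N (0 : R) k = X ^ k := by
  induction k using Nat.twoStepInduction with
  | zero => simp [sylvesterKac]
  | one => simp [sylvesterKac]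
  | more k ih1 ih2 => rw [sylvesterKac_add_two, ih2]; simp; ring

/-- For fixed `i + j = N`, the values of the Sylvester–Kac polynomials at `(i - j) μ` have the
exponential generating function `(1 + μ X)^i (1 - μ X)^j`. As this has degree `N`, the value of the
polynomial of index `N + 1` is zero. -/
lemma eval_sylvesterKac (i j k : ℕ) (μ : R) :
    (sylvesterKac (i + j) (μ ^ 2) k).eval (((i : R) - j) * μ) =
      (k ! : R) * ((1 + C μ * X) ^ i * (1 - C μ * X) ^ j : R[X]).coeff k := by
  set G : R[X] := (1 + C μ * X) ^ i * (1 - C μ * X) ^ j with hG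
  -- The first-order equation for `G` is the three-term recurrence for its coefficients.
  have hd : derivative G * (1 - C μ ^ 2 * X ^ 2) =
      (C (((i : R) - j) * μ) - C (((i : R) + j) * μ ^ 2) * X) * G := by
    have h1 : derivative ((1 + C μ * X) ^ i : R[X]) * (1 + C μ * X) =
        C ((i : R) * μ) * (1 + C μ * X) ^ i := by
      cases i with
      | zero => simp
      | succ i => simp [derivative_pow]; ring
    have h2 : derivative ((1 - C μ * X) ^ j : R[X]) * (1 - C μ * X) =
        -C ((j : R) * μ) * (1 - C μ * X) ^ j := by
      cases j with
      | zero => simp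
      | succ j => simp [derivative_pow]; ring
    rw [hG, derivative_mul]
    simp only [map_mul, map_sub, map_add, map_pow] at h1 h2 ⊢
    linear_combination (1 - C μ * X) ^ j * (1 - C μ * X) * h1 +
      (1 + C μ * X) ^ i * (1 + C μ * X) * h2
  have hG0 : G.coeff 0 = 1 := by simp [hG, coeff_zero_eq_eval_zero]
  have hcoef (k : ℕ) := congrArg (fun Q : R[X] => Q.coeff k) hd
  induction k using Nat.twoStepInduction with
  | zero => simp [sylvesterKac, hG0]
  | one =>
    have := hcoef 0
    simp [mul_coeff_zero, coeff_derivative, hG0] at this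
    simp [sylvesterKac, this]
  | more k ih1 ih2 =>
    have h3 : (derivative G * (1 - C μ ^ 2 * X ^ 2)).coeff (k + 1) =
        G.coeff (k + 2) * (k + 2) - μ ^ 2 * (G.coeff k * k) := by
      have : derivative G * (1 - C μ ^ 2 * X ^ 2) =
          derivative G - C (μ ^ 2) * (X * (X * derivative G)) := by simp; ring
      rw [this, coeff_sub, coeff_C_mul, coeff_X_mul, coeff_derivative]
      congr 1
      · push_cast; ring
      · cases k with
        | zero => simp
        | succ k => simp [coeff_X_mul, coeff_derivative]
    have h4 : ((C (((i : R) - j) * μ) - C (((i : R) + j) * μ ^ 2) * X) * G).coeff (k + 1) =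
        ((i : R) - j) * μ * G.coeff (k + 1) - ((i : R) + j) * μ ^ 2 * G.coeff k := by
      rw [sub_mul, coeff_sub, mul_assoc, coeff_C_mul, coeff_C_mul, coeff_X_mul]
    have h5 := hcoef (k + 1)
    simp only [h3, h4] at h5
    rw [sylvesterKac_add_two, eval_sub, eval_mul, eval_mul, eval_X, eval_C, ih1, ih2]
    simp only [Nat.factorial_succ]
    push_cast
    linear_combination (-((k : R) + 1) * (k ! : R)) * h5

end Algebra

lemma sylvesterKac_eq_prod {K : Type*} [Field K] [CharZero K] (N : ℕ) (μ : K) :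
    sylvesterKac N (μ ^ 2) (N + 1) =
      ∏ k ∈ Finset.range (N + 1), (X - C ((2 * (k : K) - N) * μ)) := by
  rcases eq_or_ne μ 0 with rfl | hμ
  · simp [sylvesterKac_zero_right]
  have hmon : (∏ k ∈ Finset.range (N + 1), (X - C ((2 * (k : K) - N) * μ))).Monic :=
    monic_prod_of_monic _ _ fun _ _ => monic_X_sub_C _
  refine eq_of_monic_of_dvd_of_natDegree_le
    (p := ∏ k ∈ Finset.range (N + 1), (X - C ((2 * (k : K) - N) * μ))) hmon
    (monic_sylvesterKac N _ _) ?_ ?_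
  · refine Finset.prod_dvd_of_coprime ?_ ?_
    · intro a _ b _ hab
      refine isCoprime_X_sub_C_of_isUnit_sub (IsUnit.mk0 _ ?_)
      rw [← sub_mul]
      refine mul_ne_zero ?_ hμ
      intro h
      apply hab
      have : (a : K) = b := by linear_combination h / 2
      exact_mod_cast this
    · intro k hk
      rw [dvd_iff_isRoot, IsRoot]
      have hk' : k ≤ N := Nat.lt_succ_iff.1 (Finset.mem_range.1 hk)
      obtain ⟨j, rfl⟩ := Nat.exists_eq_add_of_le hk'
      have := eval_sylvesterKac k j (k + j + 1) μ
      have e : (2 * (k : K) - (k + j : ℕ)) * μ = (k - j) * μ := by push_cast; ring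
      rw [e, this, coeff_eq_zero_of_natDegree_lt, mul_zero]
      have h1 : (1 + C μ * X : K[X]).natDegree ≤ 1 := by compute_degree
      have h2 : (1 - C μ * X : K[X]).natDegree ≤ 1 := by compute_degree
      calc _ ≤ _ := natDegree_mul_le
        _ ≤ k * 1 + j * 1 := add_le_add (natDegree_pow_le_of_le _ h1) (natDegree_pow_le_of_le _ h2)
        _ < _ := by lia
  · rw [natDegree_sylvesterKac, natDegree_prod_of_monic _ _ fun _ _ => monic_X_sub_C _]
    simp only [natDegree_X_sub_C, Finset.sum_const, Finset.card_range, smul_eq_mul, mul_one,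
      le_refl]

lemma sylvesterKacConst_pos {N : ℕ} (hN : 1 ≤ N) : 0 < sylvesterKacConst ℝ N (N + 1) := by
  refine Finset.sum_pos' (fun i hi => ?_) ⟨1, by simp; lia, ?_⟩
  · have : (i : ℝ) ≤ N + 1 := by exact_mod_cast (Finset.mem_range.1 hi).le
    exact mul_nonneg (by positivity) (by linarith)
  · have : (1 : ℝ) ≤ N := by exact_mod_cast hN
    simp; linarith

/-- The polynomial `charPoly m r`, over `ℝ`. -/
noncomputable def realCharPoly (m : ℕ) (r : Fin m → ℝ) : ℝ[X] :=
  X ^ (2 * m) + ∑ k : Fin m, C ((-1 : ℝ) ^ ((k : ℕ) + 1) * r k) * X ^ (2 * (m - ((k : ℕ) + 1)))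

section CharPoly

variable (m : ℕ) (r : Fin m → ℝ)

lemma map_realCharPoly : (realCharPoly m r).map (algebraMap ℝ ℂ) = charPoly m r := by
  simp [realCharPoly, charPoly, Polynomial.map_sum]

lemma coeff_realCharPoly (j : ℕ) : (realCharPoly m r).coeff j = (if j = 2 * m then 1 else 0) +
    ∑ k : Fin m, if j = 2 * (m - ((k : ℕ) + 1)) then (-1 : ℝ) ^ ((k : ℕ) + 1) * r k else 0 := by
  simp only [realCharPoly, coeff_add, coeff_X_pow, finsetSum_coeff, coeff_C_mul, mul_ite, mul_one,
    mul_zero]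

lemma coeff_realCharPoly_of_lt {j : ℕ} (h : 2 * m < j) : (realCharPoly m r).coeff j = 0 := by
  rw [coeff_realCharPoly, if_neg (by lia), Finset.sum_eq_zero, add_zero]
  exact fun k _ => if_neg (by lia)

lemma coeff_realCharPoly_top : (realCharPoly m r).coeff (2 * m) = 1 := by
  rw [coeff_realCharPoly, if_pos rfl, Finset.sum_eq_zero, add_zero]
  exact fun k _ => if_neg (by have := k.2; lia)

lemma coeff_realCharPoly_sub_one (hm : 1 ≤ m) : (realCharPoly m r).coeff (2 * m - 1) = 0 := by
  rw [coeff_realCharPoly, if_neg (by lia), Finset.sum_eq_zero, add_zero]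
  exact fun k _ => if_neg (by lia)

lemma coeff_realCharPoly_sub_two (hm : 1 ≤ m) :
    (realCharPoly m r).coeff (2 * m - 2) = -r ⟨0, hm⟩ := by
  rw [coeff_realCharPoly, if_neg (by lia), Finset.sum_eq_single ⟨0, hm⟩]
  · simp; lia
  · intro k _ hk
    have : (k : ℕ) ≠ 0 := fun h => hk (Fin.ext h)
    exact if_neg (by lia)
  · simp

lemma monic_realCharPoly : (realCharPoly m r).Monic :=
  monic_of_natDegree_le_of_coeff_eq_one (2 * m)
    (natDegree_le_iff_coeff_eq_zero.2 fun _ hj => coeff_realCharPoly_of_lt m r hj)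
    (coeff_realCharPoly_top m r)

end CharPoly

/-- The constant `κ` for which the polynomial of the curvatures `r` and the Sylvester–Kac
polynomial of index `2m` have the same coefficient of `X^(2m-2)`. -/
noncomputable def projectiveConst (m : ℕ) (hm : 1 ≤ m) (r : Fin m → ℝ) : ℝ :=
  r ⟨0, hm⟩ / sylvesterKacConst ℝ (2 * m - 1) (2 * m)

/-- A progression of roots of the even polynomial `charPoly m r` is symmetric about zero, so the
polynomial is a Sylvester–Kac polynomial; its `κ` is the square of half the common difference. -/
lemma isExceptional_iff {m : ℕ} (hm : 1 ≤ m) (r : Fin m → ℝ) :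
    IsExceptional m r ↔
      realCharPoly m r = sylvesterKac (2 * m - 1) (projectiveConst m hm r) (2 * m) := by
  obtain ⟨N, hN⟩ : ∃ N, 2 * m = N + 1 := ⟨2 * m - 1, by lia⟩
  have hN1 : 1 ≤ N := by lia
  have hc := sylvesterKacConst_pos hN1
  have hNs : 2 * m - 1 = N := by lia
  rw [projectiveConst, hNs, hN]
  constructor
  · rintro ⟨a, d, had⟩
    have hmon : (charPoly m r).Monic := by
      rw [← map_realCharPoly]; exact (monic_realCharPoly m r).map _
    have hprod : charPoly m r = ∏ k ∈ Finset.range (N + 1), (X - C (a + k * d)) := by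
      have h := (IsAlgClosed.splits (charPoly m r)).eq_prod_roots_of_monic hmon
      rw [had, hN, Multiset.map_map] at h
      exact h
    -- The sum of the roots is zero, which fixes the first term `a = -N d / 2`.
    have hsum : ∑ k ∈ Finset.range (N + 1), (a + k * d) = 0 := by
      have h1 : (charPoly m r).coeff N = 0 := by
        rw [← map_realCharPoly, coeff_map]
        have := coeff_realCharPoly_sub_one m r hm
        rw [hNs] at this
        simp [this]
      have h2 := Polynomial.prod_X_sub_C_coeff_card_pred (Finset.range (N + 1))
        (fun k : ℕ => a + k * d) (by simp)
      rw [Finset.card_range, Nat.add_sub_cancel, ← hprod, h1] at h2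
      simpa using h2.symm
    have ha : a = -(N * (d / 2)) := by
      rw [Finset.sum_add_distrib, ← Finset.sum_mul] at hsum
      have h3 : (∑ i ∈ Finset.range (N + 1), (i : ℂ)) * 2 = (N + 1) * N := by
        have := congrArg (Nat.cast : ℕ → ℂ) (Finset.sum_range_id_mul_two (N + 1))
        rw [Nat.add_sub_cancel] at this
        push_cast at this
        exact this
      have h4 : ((N : ℂ) + 1) ≠ 0 := by exact_mod_cast Nat.succ_ne_zero N
      simp at hsum
      apply mul_left_cancel₀ h4
      linear_combination hsum - d / 2 * h3
    have hkac : charPoly m r = sylvesterKac N ((d / 2) ^ 2) (N + 1) := by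
      rw [hprod, sylvesterKac_eq_prod]
      refine Finset.prod_congr rfl fun k _ => ?_
      rw [ha]; congr 2; ring
    have hd : ((d / 2) ^ 2 : ℂ) =
        algebraMap ℝ ℂ (r ⟨0, hm⟩ / sylvesterKacConst ℝ N (N + 1)) := by
      have h1 : (charPoly m r).coeff (N - 1) = -(r ⟨0, hm⟩ : ℂ) := by
        rw [← map_realCharPoly, coeff_map]
        have := coeff_realCharPoly_sub_two m r hm
        rw [show 2 * m - 2 = N - 1 by lia] at this
        simp [this]
      obtain ⟨M, rfl⟩ : ∃ M, N = M + 1 := ⟨N - 1, by lia⟩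
      rw [hkac, Nat.add_sub_cancel, coeff_sylvesterKac_add_two] at h1
      have h2 : sylvesterKacConst ℂ (M + 1) (M + 2) =
          ((sylvesterKacConst ℝ (M + 1) (M + 2) : ℝ) : ℂ) := by
        simp [sylvesterKacConst]
      have h3 : ((sylvesterKacConst ℝ (M + 1) (M + 2) : ℝ) : ℂ) ≠ 0 := by
        exact_mod_cast hc.ne'
      rw [h2] at h1
      simp only [Complex.coe_algebraMap, Complex.ofReal_div]
      rw [eq_div_iff h3]
      linear_combination -h1
    apply Polynomial.map_injective (algebraMap ℝ ℂ) (algebraMap ℝ ℂ).injective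
    rw [map_realCharPoly, map_sylvesterKac, ← hd, hkac]
  · intro h
    obtain ⟨μ, hμ⟩ := IsAlgClosed.exists_pow_nat_eq
      (algebraMap ℝ ℂ (r ⟨0, hm⟩ / sylvesterKacConst ℝ N (N + 1))) (n := 2) (by norm_num)
    refine ⟨-(N * μ), 2 * μ, ?_⟩
    rw [← map_realCharPoly, h, map_sylvesterKac, ← hμ, sylvesterKac_eq_prod, hN]
    have : ∏ k ∈ Finset.range (N + 1), (X - C ((2 * (k : ℂ) - N) * μ)) =
        (((Multiset.range (N + 1)).map fun k : ℕ => -(N * μ) + (k : ℂ) * (2 * μ)).map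
          fun a => X - C a).prod := by
      rw [Multiset.map_map]
      refine Finset.prod_congr rfl fun k _ => ?_
      simp only [Function.comp]
      congr 2; ring
    rw [this, roots_multiset_prod_X_sub_C]

end

/-! ### Initial spans, smooth combinations and Sylvester–Kac chains -/

section

variable {V : Type*}

section Span

variable [AddCommGroup V] [Module ℝ V]

/-- The span of `v 0, …, v (k - 1)`. -/
def initialSpan (v : ℕ → V) (k : ℕ) : Submodule ℝ V := Submodule.span ℝ (v '' Set.Iio k)

lemma mem_initialSpan {v : ℕ → V} {i k : ℕ} (h : i < k) : v i ∈ initialSpan v k :=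
  Submodule.subset_span ⟨i, h, rfl⟩

lemma initialSpan_mono (v : ℕ → V) {k l : ℕ} (h : k ≤ l) : initialSpan v k ≤ initialSpan v l :=
  Submodule.span_mono (Set.image_mono fun _ hi => lt_of_lt_of_le hi h)

lemma initialSpan_succ (v : ℕ → V) (k : ℕ) :
    initialSpan v (k + 1) = Submodule.span ℝ {v k} ⊔ initialSpan v k := by
  have : Set.Iio (k + 1) = insert k (Set.Iio k) := by ext; simp
  rw [initialSpan, initialSpan, this, Set.image_insert_eq, Submodule.span_insert]

lemma initialSpan_eq_of_triangular {u v : ℕ → V} (c : ℕ → ℝ) (hc : ∀ k, c k ≠ 0)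
    (h : ∀ k, u k - c k • v k ∈ initialSpan v k) (k : ℕ) :
    initialSpan u k = initialSpan v k := by
  induction k with
  | zero => simp [initialSpan]
  | succ k ih =>
    rw [initialSpan_succ, initialSpan_succ, ih]
    apply le_antisymm
    · refine sup_le ?_ le_sup_right
      rw [Submodule.span_singleton_le_iff_mem, ← sub_add_cancel (u k) (c k • v k), add_comm]
      exact Submodule.add_mem_sup
        (Submodule.smul_mem _ _ (Submodule.mem_span_singleton_self _)) (h k)
    · refine sup_le ?_ le_sup_right
      rw [Submodule.span_singleton_le_iff_mem]
      have : v k = (c k)⁻¹ • u k + -((c k)⁻¹ • (u k - c k • v k)) := by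
        rw [smul_sub, smul_smul, inv_mul_cancel₀ (hc k), one_smul]; abel
      rw [this]
      exact Submodule.add_mem_sup
        (Submodule.smul_mem _ _ (Submodule.mem_span_singleton_self _))
        (Submodule.neg_mem _ (Submodule.smul_mem _ _ (h k)))

lemma linearIndependent_of_initialSpan_eq_top {v : ℕ → V} {n : ℕ} (hn : 1 ≤ n)
    (hV : Module.finrank ℝ V = n) (h : initialSpan v n = ⊤) :
    LinearIndependent ℝ fun i : Fin n => v i := by
  have : FiniteDimensional ℝ V := Module.finite_of_finrank_pos (by lia)
  refine linearIndependent_of_top_le_span_of_card_eq_finrank ?_ (by simp [hV])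
  rw [← h, initialSpan]
  refine Submodule.span_mono ?_
  rintro _ ⟨i, hi, rfl⟩
  exact ⟨⟨i, hi⟩, rfl⟩

lemma eq_zero_of_smul_mem_initialSpan {v : ℕ → V} {n : ℕ}
    (h : LinearIndependent ℝ fun i : Fin n => v i) {k : ℕ} (hk : k < n) {a : ℝ}
    (ha : a • v k ∈ initialSpan v k) : a = 0 := by
  by_contra ha0
  rw [Submodule.smul_mem_iff _ ha0] at ha
  have h1 := h.notMem_span_image (s := {i : Fin n | (i : ℕ) < k}) (x := ⟨k, hk⟩) (by simp)
  apply h1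
  refine Submodule.span_mono ?_ ha
  rintro _ ⟨i, hi, rfl⟩
  exact ⟨⟨i, lt_trans hi hk⟩, hi, rfl⟩

lemma coeff_eq_zero_of_sum_range_eq_zero {v : ℕ → V} {n : ℕ}
    (h : LinearIndependent ℝ fun i : Fin n => v i) {k : ℕ} (hk : k ≤ n) {a : ℕ → ℝ}
    (ha : ∑ i ∈ Finset.range k, a i • v i = 0) : ∀ i < k, a i = 0 := by
  have h1 : LinearIndependent ℝ fun i : Fin k => v i :=
    h.comp (Fin.castLE hk) (Fin.castLE_injective hk)
  rw [Finset.sum_range] at ha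
  intro i hi
  exact Fintype.linearIndependent_iff.1 h1 (fun i => a i) ha ⟨i, hi⟩

lemma exists_sum_range_of_mem_initialSpan {v : ℕ → V} {k : ℕ} {x : V}
    (h : x ∈ initialSpan v k) : ∃ a : ℕ → ℝ, x = ∑ i ∈ Finset.range k, a i • v i := by
  induction k generalizing x with
  | zero => exact ⟨0, by simpa [initialSpan] using h⟩
  | succ k ih =>
    rw [initialSpan_succ, Submodule.mem_sup] at h
    obtain ⟨y, hy, z, hz, rfl⟩ := h
    obtain ⟨c, rfl⟩ := Submodule.mem_span_singleton.1 hy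
    obtain ⟨a, rfl⟩ := ih hz
    refine ⟨fun i => if i = k then c else a i, ?_⟩
    rw [Finset.sum_range_succ, add_comm]
    beta_reduce
    rw [if_pos rfl]
    congr 1
    refine Finset.sum_congr rfl fun i hi => ?_
    rw [if_neg (Finset.mem_range.1 hi).ne]

lemma sum_range_mem_initialSpan (v : ℕ → V) (k : ℕ) (a : ℕ → ℝ) :
    ∑ i ∈ Finset.range k, a i • v i ∈ initialSpan v k :=
  Submodule.sum_mem _ fun _ hi =>
    Submodule.smul_mem _ _ (mem_initialSpan (Finset.mem_range.1 hi))

/-- The linear map `ℝ[X] → V` that sends `X ^ i` to `v i`. For `v i = iteratedDeriv i E t` it sends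
a polynomial `Q` to `Q(d/dt) E` at `t`. -/
noncomputable def evalAt (v : ℕ → V) : ℝ[X] →ₗ[ℝ] V :=
  Polynomial.lsum fun i => LinearMap.toSpanSingleton ℝ V (v i)

lemma evalAt_C_mul_X_pow (v : ℕ → V) (c : ℝ) (i : ℕ) : evalAt v (C c * X ^ i) = c • v i := by
  rw [C_mul_X_pow_eq_monomial]
  simp [evalAt, sum_monomial_index]

lemma evalAt_X_pow (v : ℕ → V) (i : ℕ) : evalAt v (X ^ i) = v i := by
  simpa using evalAt_C_mul_X_pow v 1 i

lemma evalAt_C_mul (v : ℕ → V) (c : ℝ) (Q : ℝ[X]) : evalAt v (C c * Q) = c • evalAt v Q := by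
  rw [← smul_eq_C_mul, map_smul]

lemma evalAt_eq_sum_range (v : ℕ → V) {Q : ℝ[X]} {k : ℕ} (h : ∀ j, k ≤ j → Q.coeff j = 0) :
    evalAt v Q = ∑ i ∈ Finset.range k, Q.coeff i • v i := by
  have h1 : Q = ∑ i ∈ Finset.range k, C (Q.coeff i) * X ^ i := by
    ext j
    simp only [finsetSum_coeff, coeff_C_mul, coeff_X_pow, mul_ite, mul_one, mul_zero]
    rw [Finset.sum_ite_eq]
    split_ifs with hj
    · rfl
    · exact h j (by simpa using hj)
  conv_lhs => rw [h1]
  rw [map_sum]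
  exact Finset.sum_congr rfl fun i _ => evalAt_C_mul_X_pow v _ i

lemma evalAt_X_mul (v : ℕ → V) (Q : ℝ[X]) : evalAt v (X * Q) = evalAt (fun i => v (i + 1)) Q := by
  induction Q using Polynomial.induction_on' with
  | add p q hp hq => rw [mul_add, map_add, map_add, hp, hq]
  | monomial i c =>
    rw [← C_mul_X_pow_eq_monomial, evalAt_C_mul_X_pow,
      show X * (C c * X ^ i) = C c * X ^ (i + 1) by ring, evalAt_C_mul_X_pow]

end Span

variable [NormedAddCommGroup V] [NormedSpace ℝ V]

section SmoothComb

lemma contDiffOn_iteratedDeriv {F : Type*} [NormedAddCommGroup F] [NormedSpace ℝ F] {J : Set ℝ}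
    (hJ : IsOpen J) {G : ℝ → F} (hG : ContDiffOn ℝ ∞ G J) (i : ℕ) :
    ContDiffOn ℝ ∞ (iteratedDeriv i G) J := by
  induction i with
  | zero => simpa using hG
  | succ i ih => rw [iteratedDeriv_succ]; exact ih.deriv_of_isOpen hJ (by simp)

lemma hasDerivAt_of_contDiffOn {F : Type*} [NormedAddCommGroup F] [NormedSpace ℝ F] {J : Set ℝ}
    (hJ : IsOpen J) {G : ℝ → F} (hG : ContDiffOn ℝ ∞ G J) {t : ℝ} (ht : t ∈ J) :
    HasDerivAt G (deriv G t) t :=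
  ((hG.contDiffAt (hJ.mem_nhds ht)).differentiableAt (by simp)).hasDerivAt

lemma hasDerivAt_iteratedDeriv {F : Type*} [NormedAddCommGroup F] [NormedSpace ℝ F] {J : Set ℝ}
    (hJ : IsOpen J) {G : ℝ → F} (hG : ContDiffOn ℝ ∞ G J) (i : ℕ) {t : ℝ} (ht : t ∈ J) :
    HasDerivAt (iteratedDeriv i G) (iteratedDeriv (i + 1) G t) t := by
  rw [iteratedDeriv_succ]
  exact hasDerivAt_of_contDiffOn hJ (contDiffOn_iteratedDeriv hJ hG i) ht

/-- On `J`, the function `G` is a combination of `v 0, …, v (k - 1)` with coefficients that are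
smooth functions on `J`. -/
def SmoothComb (J : Set ℝ) (v : ℕ → ℝ → V) (k : ℕ) (G : ℝ → V) : Prop :=
  ∃ A : ℕ → ℝ → ℝ, (∀ i, ContDiffOn ℝ ∞ (A i) J) ∧
    ∀ t ∈ J, G t = ∑ i ∈ Finset.range k, A i t • v i t

namespace SmoothComb

variable {J : Set ℝ} {v : ℕ → ℝ → V} {k : ℕ} {G H : ℝ → V}

lemma congr (hG : SmoothComb J v k G) (h : ∀ t ∈ J, H t = G t) : SmoothComb J v k H := by
  obtain ⟨A, hA, hGA⟩ := hG
  exact ⟨A, hA, fun t ht => (h t ht).trans (hGA t ht)⟩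

lemma add (hG : SmoothComb J v k G) (hH : SmoothComb J v k H) :
    SmoothComb J v k fun t => G t + H t := by
  obtain ⟨A, hA, hGA⟩ := hG
  obtain ⟨B, hB, hHB⟩ := hH
  refine ⟨fun i t => A i t + B i t, fun i => (hA i).add (hB i), fun t ht => ?_⟩
  simp only [hGA t ht, hHB t ht, add_smul, Finset.sum_add_distrib]

lemma smul {a : ℝ → ℝ} (ha : ContDiffOn ℝ ∞ a J) (hG : SmoothComb J v k G) :
    SmoothComb J v k fun t => a t • G t := by
  obtain ⟨A, hA, hGA⟩ := hG
  refine ⟨fun i t => a t * A i t, fun i => ha.mul (hA i), fun t ht => ?_⟩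
  simp only [hGA t ht, Finset.smul_sum, mul_smul]

lemma zero : SmoothComb J v k fun _ => (0 : V) :=
  ⟨fun _ _ => 0, fun _ => contDiffOn_const, fun _ _ => by simp⟩

lemma neg (hG : SmoothComb J v k G) : SmoothComb J v k fun t => -G t :=
  (hG.smul (a := fun _ => -1) contDiffOn_const).congr fun t _ => by simp

lemma sub (hG : SmoothComb J v k G) (hH : SmoothComb J v k H) :
    SmoothComb J v k fun t => G t - H t :=
  (hG.add hH.neg).congr fun _ _ => sub_eq_add_neg _ _

lemma of_lt {i : ℕ} (hi : i < k) : SmoothComb J v k (v i) := by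
  refine ⟨fun j _ => if j = i then 1 else 0, fun j => contDiffOn_const, fun _ _ => ?_⟩
  simp [hi]

lemma smul_of_lt {a : ℝ → ℝ} (ha : ContDiffOn ℝ ∞ a J) {i : ℕ} (hi : i < k) :
    SmoothComb J v k fun t => a t • v i t :=
  (of_lt hi).smul ha

lemma sum {ι : Type*} (S : Finset ι) {G : ι → ℝ → V} (h : ∀ i ∈ S, SmoothComb J v k (G i)) :
    SmoothComb J v k fun t => ∑ i ∈ S, G i t := by
  classical
  induction S using Finset.induction_on with
  | empty => simpa using zero
  | insert i S hi ih =>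
    simp only [Finset.sum_insert hi]
    exact (h i (by simp)).add (ih fun j hj => h j (by simp [hj]))

lemma mono (hG : SmoothComb J v k G) {l : ℕ} (hl : k ≤ l) : SmoothComb J v l G := by
  obtain ⟨A, hA, hGA⟩ := hG
  exact (sum _ fun i hi => smul_of_lt (hA i)
    (lt_of_lt_of_le (Finset.mem_range.1 hi) hl)).congr hGA

lemma mem_initialSpan (hG : SmoothComb J v k G) {t : ℝ} (ht : t ∈ J) :
    G t ∈ initialSpan (fun i => v i t) k := by
  obtain ⟨A, hA, hGA⟩ := hG
  rw [hGA t ht]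
  exact sum_range_mem_initialSpan (fun i => v i t) k fun i => A i t

/-- If `v_i' = s v_{i+1}`, the derivative of a combination of the first `k` vectors is a combination
of the first `k + 1`. -/
lemma exists_hasDerivAt (hJ : IsOpen J) {s : ℝ → ℝ} (hs : ContDiffOn ℝ ∞ s J)
    (hv : ∀ i, ∀ t ∈ J, HasDerivAt (v i) (s t • v (i + 1) t) t) (hG : SmoothComb J v k G) :
    ∃ G' : ℝ → V, SmoothComb J v (k + 1) G' ∧ ∀ t ∈ J, HasDerivAt G (G' t) t := by
  obtain ⟨A, hA, hGA⟩ := hG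
  refine ⟨fun t => ∑ i ∈ Finset.range k, (A i t • s t • v (i + 1) t + deriv (A i) t • v i t),
    sum _ fun i hi => add ?_ ?_, fun t ht => ?_⟩
  · rw [Finset.mem_range] at hi
    exact ((of_lt (by lia)).smul hs).smul (hA i)
  · rw [Finset.mem_range] at hi
    exact (of_lt (by lia)).smul ((hA i).deriv_of_isOpen hJ (by simp))
  · have h1 : HasDerivAt (fun x => ∑ i ∈ Finset.range k, A i x • v i x)
        (∑ i ∈ Finset.range k, (A i t • s t • v (i + 1) t + deriv (A i) t • v i t)) t :=
      HasDerivAt.fun_sum fun i _ => (hasDerivAt_of_contDiffOn hJ (hA i) ht).smul (hv i t ht)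
    exact h1.congr_of_eventuallyEq (Filter.eventually_of_mem (hJ.mem_nhds ht) hGA)

end SmoothComb

variable {J : Set ℝ}

/-- The leading term of the `k`-th derivative of `f v_0`, when `v_i' = s v_{i+1}`. -/
lemma smoothComb_iteratedDeriv_sub (hJ : IsOpen J) {v : ℕ → ℝ → V} {s f : ℝ → ℝ} {G : ℝ → V}
    (hs : ContDiffOn ℝ ∞ s J) (hf : ContDiffOn ℝ ∞ f J) (hGs : ContDiffOn ℝ ∞ G J)
    (hv : ∀ i, ∀ t ∈ J, HasDerivAt (v i) (s t • v (i + 1) t) t)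
    (hG : ∀ t ∈ J, G t = f t • v 0 t) (k : ℕ) :
    SmoothComb J v k fun t => iteratedDeriv k G t - (f t * s t ^ k) • v k t := by
  induction k with
  | zero => exact SmoothComb.zero.congr fun t ht => by simp [hG t ht]
  | succ k ih =>
    obtain ⟨G', hG', hd⟩ := ih.exists_hasDerivAt hJ hs hv
    have hfs : ContDiffOn ℝ ∞ (fun t => f t * s t ^ k) J := hf.mul (hs.pow k)
    refine (hG'.add (SmoothComb.smul_of_lt (hfs.deriv_of_isOpen hJ (by simp))
      (Nat.lt_succ_self k))).congr fun t ht => ?_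
    have h1 := (hasDerivAt_iteratedDeriv hJ hGs k ht).sub
      ((hasDerivAt_of_contDiffOn hJ hfs ht).smul (hv k t ht))
    have h2 := (hd t ht).unique h1
    rw [h2, smul_smul]
    ring_nf
    abel

/-- The two leading terms of the `(k + 1)`-st derivative of `g F`. -/
lemma smoothComb_iteratedDeriv_smul (hJ : IsOpen J) {F : ℝ → V} {g : ℝ → ℝ}
    (hF : ContDiffOn ℝ ∞ F J) (hg : ContDiffOn ℝ ∞ g J) {G : ℝ → V} (hGs : ContDiffOn ℝ ∞ G J)
    (hG : ∀ t ∈ J, G t = g t • F t) (k : ℕ) :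
    SmoothComb J (fun i => iteratedDeriv i F) k fun t =>
      iteratedDeriv (k + 1) G t - g t • iteratedDeriv (k + 1) F t -
        (((k : ℝ) + 1) * deriv g t) • iteratedDeriv k F t := by
  have hv : ∀ i, ∀ t ∈ J, HasDerivAt (iteratedDeriv i F)
      ((1 : ℝ) • iteratedDeriv (i + 1) F t) t := fun i t ht => by
    rw [one_smul]; exact hasDerivAt_iteratedDeriv hJ hF i ht
  have hg' : ContDiffOn ℝ ∞ (deriv g) J := hg.deriv_of_isOpen hJ (by simp)
  have hg'' : ContDiffOn ℝ ∞ (deriv (deriv g)) J := hg'.deriv_of_isOpen hJ (by simp)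
  induction k with
  | zero =>
    refine SmoothComb.zero.congr fun t ht => ?_
    have h1 : HasDerivAt G (g t • iteratedDeriv 1 F t + deriv g t • F t) t := by
      refine HasDerivAt.congr_of_eventuallyEq ?_ (Filter.eventually_of_mem (hJ.mem_nhds ht) hG)
      have := hv 0 t ht
      rw [iteratedDeriv_zero, one_smul] at this
      exact (hasDerivAt_of_contDiffOn hJ hg ht).smul this
    have h2 := (hasDerivAt_iteratedDeriv hJ hGs 0 ht)
    rw [iteratedDeriv_zero] at h2
    rw [h2.unique h1]
    simp
  | succ k ih =>
    obtain ⟨G', hG', hd⟩ := ih.exists_hasDerivAt hJ (s := fun _ => 1) contDiffOn_const hv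
    refine (hG'.add (SmoothComb.smul_of_lt
      (a := fun t => ((k : ℝ) + 1) * deriv (deriv g) t) (contDiffOn_const.mul hg'')
      (Nat.lt_succ_self k))).congr fun t ht => ?_
    have h1 := ((hasDerivAt_iteratedDeriv hJ hGs (k + 1) ht).sub
      ((hasDerivAt_of_contDiffOn hJ hg ht).smul (hv (k + 1) t ht))).sub
      (((hasDerivAt_of_contDiffOn hJ hg' ht).const_mul ((k : ℝ) + 1)).smul (hv k t ht))
    rw [(hd t ht).unique h1]
    push_cast
    module

lemma iteratedDeriv_smul_of_deriv_eq_zero (hJ : IsOpen J) {F : ℝ → V} {g : ℝ → ℝ}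
    (hF : ContDiffOn ℝ ∞ F J) (hg : ∀ t ∈ J, HasDerivAt g 0 t) {G : ℝ → V}
    (hG : ∀ t ∈ J, G t = g t • F t) (k : ℕ) :
    ∀ t ∈ J, iteratedDeriv k G t = g t • iteratedDeriv k F t := by
  induction k with
  | zero => simpa using hG
  | succ k ih =>
    intro t ht
    rw [iteratedDeriv_succ]
    have h1 : HasDerivAt (iteratedDeriv k G)
        (g t • iteratedDeriv (k + 1) F t + (0 : ℝ) • iteratedDeriv k F t) t :=
      ((hg t ht).smul (hasDerivAt_iteratedDeriv hJ hF k ht)).congr_of_eventuallyEq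
        (Filter.eventually_of_mem (hJ.mem_nhds ht) ih)
    rw [h1.deriv]; simp

end SmoothComb

section Chain

/-- On `J`, the derivative of `u_k` is `s (u_{k+1} + k (N + 1 - k) q u_{k-1})` for `k ≤ N`: with
respect to a parameter of speed `s`, the functions `u_0, …, u_{N+1}` arise from `u_0` by the
Sylvester–Kac recursion with potential `q`. For `k = 0` the index `k - 1 = 0` is harmless, as its
coefficient vanishes. -/
def IsKacChain (J : Set ℝ) (N : ℕ) (s q : ℝ → ℝ) (u : ℕ → ℝ → V) : Prop :=
  ∀ k ≤ N, ∀ t ∈ J, HasDerivAt (u k)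
    (s t • (u (k + 1) t + ((k : ℝ) * ((N : ℝ) + 1 - k) * q t) • u (k - 1) t)) t

variable {J : Set ℝ} {N : ℕ}

lemma IsKacChain.smoothComb_sub (hJ : IsOpen J) {q : ℝ → ℝ} {u : ℕ → ℝ → V}
    (hq : ContDiffOn ℝ ∞ q J) (hu : IsKacChain J N (fun _ => 1) q u)
    {F : ℝ → V} (hF : ContDiffOn ℝ ∞ F J) (hF0 : ∀ t ∈ J, F t = u 0 t) (k : ℕ) (hk : k ≤ N + 1) :
    SmoothComb J (fun i => iteratedDeriv i F) k fun t => u k t - iteratedDeriv k F t := by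
  have hv : ∀ i, ∀ t ∈ J, HasDerivAt (iteratedDeriv i F)
      ((1 : ℝ) • iteratedDeriv (i + 1) F t) t := fun i t ht => by
    rw [one_smul]; exact hasDerivAt_iteratedDeriv hJ hF i ht
  induction k using Nat.strong_induction_on with
  | _ k ih =>
    cases k with
    | zero => exact SmoothComb.zero.congr fun t ht => by simp [hF0 t ht]
    | succ k =>
      obtain ⟨G', hG', hd⟩ :=
        (ih k (by lia) (by lia)).exists_hasDerivAt hJ (s := fun _ => 1) contDiffOn_const hv
      have h1 : SmoothComb J (fun i => iteratedDeriv i F) (k + 1)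
          fun t => ((k : ℝ) * ((N : ℝ) + 1 - k) * q t) • u (k - 1) t := by
        rcases Nat.eq_zero_or_pos k with rfl | hk0
        · exact SmoothComb.zero.congr fun t _ => by simp
        · refine SmoothComb.smul (contDiffOn_const.mul hq) ?_
          have h2 := (ih (k - 1) (by lia) (by lia)).mono (l := k + 1) (by lia)
          exact (h2.add (SmoothComb.of_lt (i := k - 1) (by lia))).congr fun t _ => by simp
      refine (hG'.sub h1).congr fun t ht => ?_
      rw [(hd t ht).unique ((hu k (by lia) t ht).sub (hv k t ht))]
      module

/-- The `(k + 2)`-nd derivative of the first term of a chain of unit speed, up to combinations of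
derivatives of order less than `k`. -/
lemma IsKacChain.smoothComb_iteratedDeriv (hJ : IsOpen J) {q : ℝ → ℝ} {u : ℕ → ℝ → V}
    (hq : ContDiffOn ℝ ∞ q J) (hu : IsKacChain J N (fun _ => 1) q u)
    {F : ℝ → V} (hF : ContDiffOn ℝ ∞ F J) (hF0 : ∀ t ∈ J, F t = u 0 t) (k : ℕ)
    (hk : k + 2 ≤ N + 1) :
    SmoothComb J (fun i => iteratedDeriv i F) k fun t =>
      iteratedDeriv (k + 2) F t - u (k + 2) t -
        (sylvesterKacConst ℝ N (k + 2) * q t) • iteratedDeriv k F t := by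
  have hv : ∀ i, ∀ t ∈ J, HasDerivAt (iteratedDeriv i F)
      ((1 : ℝ) • iteratedDeriv (i + 1) F t) t := fun i t ht => by
    rw [one_smul]; exact hasDerivAt_iteratedDeriv hJ hF i ht
  have h01 : ∀ t ∈ J, iteratedDeriv 1 F t = u 1 t := fun t ht => by
    have h1 := hu 0 (by lia) t ht
    have h2 := h1.congr_of_eventuallyEq (Filter.eventually_of_mem (hJ.mem_nhds ht) hF0)
    have h3 := hv 0 t ht
    rw [iteratedDeriv_zero] at h3
    simpa using h3.unique h2
  induction k with
  | zero =>
    refine SmoothComb.zero.congr fun t ht => ?_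
    have h1 := (hu 1 (by lia) t ht).congr_of_eventuallyEq
      (Filter.eventually_of_mem (hJ.mem_nhds ht) h01)
    have h3 := h1.unique (hv 1 t ht)
    simp only [one_smul, Nat.sub_self, ← hF0 t ht] at h3
    simp only [zero_add, ← h3, iteratedDeriv_zero, sylvesterKacConst, Finset.sum_range_succ,
      Finset.sum_range_zero]
    push_cast
    module
  | succ k ih =>
    obtain ⟨G', hG', hd⟩ :=
      (ih (by lia)).exists_hasDerivAt hJ (s := fun _ => 1) contDiffOn_const hv
    have hcq : ContDiffOn ℝ ∞ (fun t => sylvesterKacConst ℝ N (k + 2) * q t) J :=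
      contDiffOn_const.mul hq
    have hu1 := hu.smoothComb_sub hJ hq hF hF0 (k + 1) (by lia)
    have h1 := hu1.smul (a := fun t => (((k + 2 : ℕ) : ℝ) * ((N : ℝ) + 1 - (k + 2 : ℕ)) * q t))
      (contDiffOn_const.mul hq)
    have h2 := SmoothComb.smul_of_lt (v := fun i => iteratedDeriv i F)
      (hcq.deriv_of_isOpen hJ (by simp)) (Nat.lt_succ_self k)
    refine ((hG'.add h1).add h2).congr fun t ht => ?_
    have h3 := ((hv (k + 2) t ht).sub (hu (k + 2) (by lia) t ht)).sub
      ((hasDerivAt_of_contDiffOn hJ hcq ht).smul (hv k t ht))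
    rw [(hd t ht).unique h3]
    have h4 : sylvesterKacConst ℝ N (k + 1 + 2) = sylvesterKacConst ℝ N (k + 2) +
        ((k + 2 : ℕ) : ℝ) * ((N : ℝ) + 1 - (k + 2 : ℕ)) := by
      rw [sylvesterKacConst, Finset.sum_range_succ, sylvesterKacConst]
    rw [h4, show k + 2 - 1 = k + 1 by lia]
    push_cast
    module

/-- A chain of unit speed with zero potential consists of the derivatives of its first term. -/
lemma IsKacChain.iteratedDeriv_eq (hJ : IsOpen J) {q : ℝ → ℝ} {u : ℕ → ℝ → V}
    (hq : ∀ t ∈ J, q t = 0) (hu : IsKacChain J N (fun _ => 1) q u)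
    {F : ℝ → V} (hF0 : ∀ t ∈ J, F t = u 0 t) (k : ℕ) (hk : k ≤ N + 1) :
    ∀ t ∈ J, iteratedDeriv k F t = u k t := by
  induction k with
  | zero => simpa using hF0
  | succ k ih =>
    intro t ht
    rw [iteratedDeriv_succ, ((hu k (by lia) t ht).congr_of_eventuallyEq
      (Filter.eventually_of_mem (hJ.mem_nhds ht) (ih (by lia)))).deriv]
    simp [hq t ht]

lemma isKacChain_evalAt {E : ℝ → V} (hE : ContDiff ℝ ∞ E) (κ : ℝ) {υ s : ℝ → ℝ}
    (hυ : ∀ t ∈ J, HasDerivAt υ (s t) t) :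
    IsKacChain J N s (fun _ => κ) fun k t =>
      evalAt (fun i => iteratedDeriv i E (υ t)) (sylvesterKac N κ k) := by
  intro k _ t ht
  have hE' : ContDiffOn ℝ ∞ E Set.univ := hE.contDiffOn
  have hD (Q : ℝ[X]) : HasDerivAt (fun x => evalAt (fun i => iteratedDeriv i E (υ x)) Q)
      (s t • evalAt (fun i => iteratedDeriv i E (υ t)) (X * Q)) t := by
    have h0 : ∀ j, Q.natDegree + 1 ≤ j → Q.coeff j = 0 := fun j hj =>
      coeff_eq_zero_of_natDegree_lt hj
    rw [evalAt_X_mul, evalAt_eq_sum_range _ h0, Finset.smul_sum]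
    simp only [evalAt_eq_sum_range _ h0]
    refine HasDerivAt.fun_sum fun i _ => ?_
    rw [smul_comm]
    exact ((hasDerivAt_iteratedDeriv isOpen_univ hE' i (Set.mem_univ _)).scomp t
      (hυ t ht)).const_smul _
  convert hD (sylvesterKac N κ k) using 2
  rw [← evalAt_C_mul, ← map_add]
  congr 1
  cases k with
  | zero => simp [sylvesterKac]
  | succ k =>
    rw [sylvesterKac_add_two, Nat.add_sub_cancel]
    have : ((k : ℝ) + 1) * (N - k) * κ = ((k + 1 : ℕ) : ℝ) * (N + 1 - (k + 1 : ℕ)) * κ := by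
      push_cast; ring
    rw [this]
    ring

end Chain

end

/-! ### Covariance of chains under a change of parameter -/

section

section PolynomialCurve

/-- The coefficientwise derivative at `t` of a curve of polynomials is `Q'`. -/
def HasPolyDerivAt (Q : ℝ → ℝ[X]) (Q' : ℝ[X]) (t : ℝ) : Prop :=
  ∀ l, HasDerivAt (fun x => (Q x).coeff l) (Q'.coeff l) t

lemma HasPolyDerivAt.C {f : ℝ → ℝ} {f' t : ℝ} (h : HasDerivAt f f' t) :
    HasPolyDerivAt (fun x => C (f x)) (C f') t := by
  intro l
  cases l with
  | zero => simpa using h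
  | succ l => simpa [coeff_C] using hasDerivAt_const t (0 : ℝ)

lemma HasPolyDerivAt.const (P : ℝ[X]) (t : ℝ) : HasPolyDerivAt (fun _ => P) 0 t :=
  fun l => by simpa using hasDerivAt_const t (P.coeff l)

lemma HasPolyDerivAt.add {P Q : ℝ → ℝ[X]} {P' Q' : ℝ[X]} {t : ℝ} (hP : HasPolyDerivAt P P' t)
    (hQ : HasPolyDerivAt Q Q' t) : HasPolyDerivAt (fun x => P x + Q x) (P' + Q') t :=
  fun l => by simpa only [coeff_add] using (hP l).fun_add (hQ l)

lemma HasPolyDerivAt.mul {P Q : ℝ → ℝ[X]} {P' Q' : ℝ[X]} {t : ℝ} (hP : HasPolyDerivAt P P' t)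
    (hQ : HasPolyDerivAt Q Q' t) : HasPolyDerivAt (fun x => P x * Q x) (P' * Q t + P t * Q') t := by
  intro l
  simp only [coeff_add, coeff_mul, ← Finset.sum_add_distrib]
  exact HasDerivAt.fun_sum fun i _ => (hP i.1).mul (hQ i.2)

lemma HasPolyDerivAt.pow {P : ℝ → ℝ[X]} {P' : ℝ[X]} {t : ℝ} (hP : HasPolyDerivAt P P' t) (k : ℕ) :
    HasPolyDerivAt (fun x => P x ^ k) (k * P t ^ (k - 1) * P') t := by
  induction k with
  | zero => simpa using HasPolyDerivAt.const 1 t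
  | succ k ih =>
    simp only [pow_succ]
    convert ih.mul hP using 1
    cases k with
    | zero => simp
    | succ k => simp; ring

end PolynomialCurve

variable {V : Type*} [NormedAddCommGroup V] [NormedSpace ℝ V] {J : Set ℝ} {N : ℕ}

/-- The terms of a chain in the normalization of the monomials `y^(N-l) y'^l` of a solution of
`y'' = q y`, extended by zero to `l > N`. -/
noncomputable def sympowVector (N : ℕ) (u : ℕ → V) (l : ℕ) : V :=
  if l ≤ N then (((N - l)! : ℝ) / (N ! : ℝ)) • u l else 0

/-- The action of `y ↦ y'`, `y' ↦ q y` on monomials `y^(N-l) y'^l`, written as a differential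
operator on polynomials in `X = y'/y`. -/
lemma evalAt_sympow (z : ℕ → V) (q : ℝ) (Q : ℝ[X]) :
    evalAt (fun l => ((N : ℝ) - l) • z (l + 1) + ((l : ℝ) * q) • z (l - 1)) Q =
      evalAt z (C (N : ℝ) * X * Q - X ^ 2 * derivative Q + C q * derivative Q) := by
  induction Q using Polynomial.induction_on' with
  | add P Q hP hQ =>
    rw [map_add, hP, hQ, ← map_add, derivative_add]
    congr 1; ring
  | monomial l c =>
    rw [← C_mul_X_pow_eq_monomial, evalAt_C_mul_X_pow]
    have : C (N : ℝ) * X * (C c * X ^ l) - X ^ 2 * derivative (C c * X ^ l) +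
        C q * derivative (C c * X ^ l) = C (c * ((N : ℝ) - l)) * X ^ (l + 1) +
          C (c * (l * q)) * X ^ (l - 1) := by
      cases l with
      | zero => simp; ring
      | succ l => simp; ring
    rw [this, map_add, evalAt_C_mul_X_pow, evalAt_C_mul_X_pow]
    module

lemma IsKacChain.hasDerivAt_sympowVector {s q : ℝ → ℝ} {u : ℕ → ℝ → V}
    (hu : IsKacChain J N s q u) {t : ℝ} (ht : t ∈ J) {l : ℕ} (hl : l ≤ N) :
    HasDerivAt (fun x => sympowVector N (fun k => u k x) l)
      (s t • (((N : ℝ) - l) • sympowVector N (fun k => u k t) (l + 1) +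
        ((l : ℝ) * q t) • sympowVector N (fun k => u k t) (l - 1) +
        if l = N then (1 / (N ! : ℝ)) • u (N + 1) t else 0)) t := by
  have h1 := (hu l hl t ht).const_smul (((N - l)! : ℝ) / (N ! : ℝ))
  simp only [sympowVector, if_pos hl, if_pos (show l - 1 ≤ N by lia)]
  have h2 : (((N - l)! : ℝ) / (N ! : ℝ)) * ((l : ℝ) * ((N : ℝ) + 1 - l) * q t) =
      (l : ℝ) * q t * (((N - (l - 1))! : ℝ) / (N ! : ℝ)) := by
    cases l with
    | zero => simp
    | succ l =>
      rw [show N - (l + 1 - 1) = (N - (l + 1)) + 1 by lia, Nat.factorial_succ]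
      push_cast [Nat.cast_sub hl]
      ring
  have h3 : (((N - l)! : ℝ) / (N ! : ℝ)) • ((l : ℝ) * ((N : ℝ) + 1 - l) * q t) • u (l - 1) t =
      ((l : ℝ) * q t) • (((N - (l - 1))! : ℝ) / (N ! : ℝ)) • u (l - 1) t := by
    rw [smul_smul, h2, mul_smul]
  refine h1.congr_deriv ?_
  symm
  rw [smul_comm _ (s t), smul_add _ (u (l + 1) t), h3]
  congr 1
  rcases hl.lt_or_eq with h | rfl
  · have h3 : ((N : ℝ) - l) * ((N - (l + 1))! : ℝ) = ((N - l)! : ℝ) := by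
      rw [show N - l = (N - (l + 1)) + 1 by lia, Nat.factorial_succ]
      push_cast [Nat.cast_sub (show l + 1 ≤ N from h)]
      ring
    rw [if_pos (show l + 1 ≤ N from h), if_neg h.ne, ← h3]
    module
  · simp; abel

/-- The derivative of a polynomial curve of degree at most `N` evaluated at a chain. The chain fails
to be a symmetric power exactly by its last term, which enters through the coefficient of `X^N`. -/
lemma IsKacChain.hasDerivAt_evalAt {s q : ℝ → ℝ} {u : ℕ → ℝ → V}
    (hu : IsKacChain J N s q u) {t : ℝ} (ht : t ∈ J) {Q : ℝ → ℝ[X]} {Q' : ℝ[X]}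
    (hQ : HasPolyDerivAt Q Q' t) (hQN : ∀ x, (Q x).natDegree ≤ N) (hQN' : Q'.natDegree ≤ N) :
    HasDerivAt (fun x => evalAt (sympowVector N fun k => u k x) (Q x))
      (evalAt (sympowVector N fun k => u k t) (Q' + C (s t) *
        (C (N : ℝ) * X * Q t - X ^ 2 * derivative (Q t) + C (q t) * derivative (Q t))) +
        (s t * (Q t).coeff N / (N ! : ℝ)) • u (N + 1) t) t := by
  have h0 {P : ℝ[X]} (hP : P.natDegree ≤ N) : ∀ j, N + 1 ≤ j → P.coeff j = 0 := fun j hj =>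
    coeff_eq_zero_of_natDegree_lt (by lia)
  simp only [fun x => evalAt_eq_sum_range (sympowVector N fun k => u k x) (h0 (hQN x))]
  have h1 : HasDerivAt (fun x => ∑ i ∈ Finset.range (N + 1),
      (Q x).coeff i • sympowVector N (fun k => u k x) i) _ t :=
    HasDerivAt.fun_sum fun i hi =>
      (hQ i).smul (hu.hasDerivAt_sympowVector ht (Nat.lt_succ_iff.1 (Finset.mem_range.1 hi)))
  convert h1 using 1
  rw [map_add, evalAt_C_mul, ← evalAt_sympow, evalAt_eq_sum_range _ (h0 hQN'),
    evalAt_eq_sum_range _ (h0 (hQN t)), Finset.sum_add_distrib, Finset.smul_sum]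
  have h2 : ∀ i, (Q t).coeff i • s t • (((N : ℝ) - i) • sympowVector N (fun k => u k t) (i + 1) +
        ((i : ℝ) * q t) • sympowVector N (fun k => u k t) (i - 1) +
        if i = N then (1 / (N ! : ℝ)) • u (N + 1) t else 0) =
      s t • (Q t).coeff i • (((N : ℝ) - i) • sympowVector N (fun k => u k t) (i + 1) +
        ((i : ℝ) * q t) • sympowVector N (fun k => u k t) (i - 1)) +
      if i = N then (s t * (Q t).coeff N / (N ! : ℝ)) • u (N + 1) t else 0 := by
    intro i
    split_ifs with h
    · subst h; module
    · module
  simp only [h2, Finset.sum_add_distrib]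
  rw [Finset.sum_ite_eq' (Finset.range (N + 1)) N, if_pos (by simp)]
  abel

/-- The Leibniz rule for `ỹ^i ỹ'^k` in the coordinates `X = y'/y`: here `W` is the weight, with
derivative `a`, the polynomial `L = a + W S X` stands for `ỹ' = (W y)'`, and `Q` is the new
potential, `(ỹ')' = Q ỹ`. -/
lemma sympow_covariance {A : Type*} [CommRing A] {W S S' a a' q Q X L : A}
    (hW : W * S' = -(2 * a * S)) (hQ : Q * W = a' + q * S ^ 2 * W) (hL : L = a + W * S * X)
    (i k : ℕ) :
    (i : A) * W ^ (i - 1) * a * L ^ k +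
        W ^ i * ((k : A) * L ^ (k - 1) * (a' + (a * S + W * S') * X)) +
      S * (((i + k : ℕ) : A) * X * (W ^ i * L ^ k) -
        X ^ 2 * (W ^ i * ((k : A) * L ^ (k - 1) * (W * S))) +
          q * (W ^ i * ((k : A) * L ^ (k - 1) * (W * S)))) =
      (i : A) * (W ^ (i - 1) * L ^ (k + 1)) + (k : A) * Q * (W ^ (i + 1) * L ^ (k - 1)) := by
  rcases i with _ | i <;> rcases k with _ | j
  · simp
  · simp only [Nat.add_sub_cancel]
    push_cast
    linear_combination ((j + 1 : A) * L ^ j * X) * hW - ((j + 1 : A) * L ^ j) * hQ +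
      ((j + 1 : A) * L ^ j * S * X) * hL
  · simp only [Nat.add_sub_cancel]
    push_cast
    linear_combination (-(i + 1 : A) * W ^ i) * hL
  · simp only [Nat.add_sub_cancel]
    push_cast
    linear_combination ((j + 1 : A) * W ^ (i + 1) * L ^ j * X) * hW -
      ((j + 1 : A) * W ^ (i + 1) * L ^ j) * hQ +
      ((j + 1 : A) * W ^ (i + 1) * L ^ j * S * X - (i + 1 : A) * W ^ i * L ^ (j + 1)) * hL

/-- Covariance of the symmetric power of a second-order equation: if `w² s` is locally constant,
then multiplication by `w^N` carries a chain of speed `s` and potential `q` to one of unit speed and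
potential `w''/w + q s²`, and multiplies the last term by `w^N s^(N+1)`. The new terms are obtained
from the monomials `y^(N-k) y'^k` by the substitution `y ↦ w y`, `y' ↦ w' y + w s y'`. -/
theorem IsKacChain.reparam {s s' q w a a' : ℝ → ℝ} {u : ℕ → ℝ → V} (hu : IsKacChain J N s q u)
    (hw : ∀ t ∈ J, HasDerivAt w (a t) t) (ha : ∀ t ∈ J, HasDerivAt a (a' t) t)
    (hs : ∀ t ∈ J, HasDerivAt s (s' t) t) (hw0 : ∀ t ∈ J, w t ≠ 0)
    (hws : ∀ t ∈ J, 2 * a t * s t + w t * s' t = 0) :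
    ∃ T : ℕ → ℝ → V, IsKacChain J N (fun _ => 1) (fun t => a' t / w t + q t * s t ^ 2) T ∧
      (∀ t, T 0 t = w t ^ N • u 0 t) ∧
      ∀ t, T (N + 1) t = (w t ^ N * s t ^ (N + 1)) • u (N + 1) t := by
  set L : ℝ → ℝ[X] := fun t => C (a t) + C (w t * s t) * X with hL
  set z : ℝ → ℕ → V := fun t => sympowVector N fun k => u k t with hz
  set T : ℕ → ℝ → V := fun k t =>
    if k ≤ N then (N.descFactorial k : ℝ) • evalAt (z t) (C (w t ^ (N - k)) * L t ^ k)
    else (w t ^ N * s t ^ (N + 1)) • u (N + 1) t with hT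
  have hL1 (t : ℝ) : (L t).natDegree ≤ 1 := by simp only [hL]; compute_degree
  have hLpow (t : ℝ) (k : ℕ) : (L t ^ k).natDegree ≤ k := by
    simpa using natDegree_pow_le_of_le k (hL1 t)
  have hLd (t : ℝ) : derivative (L t) = C (w t * s t) := by simp [hL]
  refine ⟨T, fun k hk t ht => ?_, fun t => ?_, fun t => by simp [hT]⟩
  · set Q : ℝ → ℝ[X] := fun t => C (w t ^ (N - k)) * L t ^ k with hQ
    have hw1 := hw t ht
    have hLt : HasPolyDerivAt L (C (a' t) + C (a t * s t + w t * s' t) * X) t := by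
      have := (HasPolyDerivAt.C (ha t ht)).add
        ((HasPolyDerivAt.C (hw1.mul (hs t ht))).mul (HasPolyDerivAt.const X t))
      simpa [hL] using this
    have hQt := (HasPolyDerivAt.C (hw1.fun_pow (N - k))).mul (hLt.pow k)
    have hQN (x : ℝ) : (Q x).natDegree ≤ N := by
      refine (natDegree_C_mul_le _ _).trans ((hLpow x k).trans hk)
    have hbd : (C (a' t) + C (a t * s t + w t * s' t) * X : ℝ[X]).natDegree ≤ 1 := by
      compute_degree
    have hd := hu.hasDerivAt_evalAt ht hQt hQN ?_
    swap
    · refine natDegree_add_le_of_degree_le ?_ ?_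
      · exact (natDegree_C_mul_le _ _).trans ((hLpow t k).trans hk)
      · refine (natDegree_C_mul_le _ _).trans ?_
        cases k with
        | zero => simp
        | succ k =>
          rw [mul_assoc, ← C_eq_natCast]
          refine (natDegree_C_mul_le _ _).trans (natDegree_mul_le.trans ?_)
          have := hLpow t k
          simp only [Nat.add_sub_cancel]
          lia
    have hTk : T k = fun x => (N.descFactorial k : ℝ) • evalAt (z x) (Q x) := by
      funext x; simp only [hT, if_pos hk, hQ]
    rw [hTk]
    refine (hd.const_smul (N.descFactorial k : ℝ)).congr_deriv ?_
    have hw0t := hw0 t ht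
    have e1 : C (w t) * C (s' t) = -(2 * C (a t) * C (s t) : ℝ[X]) := by
      rw [← C_mul, show w t * s' t = -(2 * a t * s t) by linarith [hws t ht], C_neg, C_mul, C_mul]
      rfl
    have e2 : C (a' t / w t + q t * s t ^ 2) * C (w t) =
        (C (a' t) + C (q t) * C (s t) ^ 2 * C (w t) : ℝ[X]) := by
      rw [← C_mul, show (a' t / w t + q t * s t ^ 2) * w t = a' t + q t * s t ^ 2 * w t by
        field_simp]
      simp
    have e3 : L t = C (a t) + C (w t) * C (s t) * X := by simp [hL]
    have e4 : C (((N - k : ℕ) : ℝ) * w t ^ (N - k - 1) * a t) * L t ^ k +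
        C (w t ^ (N - k)) * ((k : ℝ[X]) * L t ^ (k - 1) *
          (C (a' t) + C (a t * s t + w t * s' t) * X)) + C (s t) *
        (C (N : ℝ) * X * Q t - X ^ 2 * derivative (Q t) + C (q t) * derivative (Q t)) =
        C (((N - k : ℕ) : ℝ)) * (C (w t ^ (N - k - 1)) * L t ^ (k + 1)) +
          C ((k : ℝ) * (a' t / w t + q t * s t ^ 2)) *
            (C (w t ^ (N - k + 1)) * L t ^ (k - 1)) := by
      have h := sympow_covariance (e1) e2 e3 (N - k) k
      rw [Nat.sub_add_cancel hk] at h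
      simp only [hQ, derivative_mul, derivative_C, derivative_pow, hLd,
        C_mul, C_add, C_pow, C_eq_natCast] at h e1 e2 ⊢
      linear_combination h
    simp only [hQ] at e4
    rw [e4]
    have e5 : ((k : ℝ) * ((N : ℝ) + 1 - k) * (a' t / w t + q t * s t ^ 2)) • T (k - 1) t =
        (N.descFactorial k : ℝ) • ((k : ℝ) * (a' t / w t + q t * s t ^ 2)) •
          evalAt (sympowVector N fun k => u k t) (C (w t ^ (N - k + 1)) * L t ^ (k - 1)) := by
      cases k with
      | zero => simp
      | succ j =>
        simp only [hT, hz, Nat.add_sub_cancel, if_pos (show j ≤ N by lia)]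
        rw [show N - (j + 1) + 1 = N - j by lia, Nat.descFactorial_succ]
        push_cast [Nat.cast_sub (show j ≤ N by lia)]
        module
    have e6 : T (k + 1) t = (N.descFactorial k : ℝ) • (((N - k : ℕ) : ℝ) •
        evalAt (sympowVector N fun k => u k t) (C (w t ^ (N - k - 1)) * L t ^ (k + 1)) +
          (s t * (C (w t ^ (N - k)) * L t ^ k).coeff N / (N ! : ℝ)) • u (N + 1) t) := by
      rcases hk.lt_or_eq with h | rfl
      · have h1 : (C (w t ^ (N - k)) * L t ^ k).coeff N = 0 := by
          refine coeff_eq_zero_of_natDegree_lt ((natDegree_C_mul_le _ _).trans_lt ?_)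
          exact (hLpow t k).trans_lt h
        rw [h1]
        simp only [hT, hz, if_pos (show k + 1 ≤ N from h)]
        rw [Nat.descFactorial_succ, show N - k - 1 = N - (k + 1) by lia]
        push_cast
        module
      · have h1 : (C (w t ^ (k - k)) * L t ^ k).coeff k = (w t * s t) ^ k := by
          rw [Nat.sub_self, pow_zero, C_1, one_mul]
          have := coeff_pow_of_natDegree_le (m := k) (hL1 t)
          rw [mul_one] at this
          rw [this]
          simp [hL]
        rw [h1]
        have h2 : (k ! : ℝ) ≠ 0 := by positivity
        simp only [hT, Nat.descFactorial_self]
        rw [if_neg (by lia)]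
        simp only [Nat.sub_self, Nat.cast_zero, zero_smul, zero_add, smul_smul]
        congr 1
        field_simp
        ring
    beta_reduce
    rw [map_add, evalAt_C_mul _ ((N - k : ℕ) : ℝ), evalAt_C_mul _ ((k : ℝ) * _), one_smul, e5, e6]
    module
  · have h2 : (N ! : ℝ) ≠ 0 := by positivity
    simp only [hT, hz, if_pos (Nat.zero_le N), Nat.sub_zero, evalAt_C_mul]
    have h := evalAt_X_pow (sympowVector N fun k => u k t) 0
    rw [pow_zero] at h
    rw [pow_zero, h]
    simp [sympowVector, h2]

end

/-! ### Wilczynski invariants, projective parameters and adapted lifts -/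

section

section Wilczynski

lemma iteratedDeriv_eq_zero_of_isOpen {J : Set ℝ} (hJ : IsOpen J) {f : ℝ → ℝ}
    (hf : ∀ t ∈ J, f t = 0) (k : ℕ) {t : ℝ} (ht : t ∈ J) : iteratedDeriv k f t = 0 := by
  have h : f =ᶠ[nhds t] fun _ => 0 := Filter.eventually_of_mem (hJ.mem_nhds ht) hf
  rw [h.iteratedDeriv_eq]
  simp

lemma wilczynski_eq_zero {m : ℕ} {J : Set ℝ} (hJ : IsOpen J) {B : ℕ → ℝ → ℝ}
    (hB : ∀ i < 2 * m - 2, ∀ t ∈ J, B i t = 0) {i : ℕ} (hi : i ∈ Finset.Icc 1 (2 * m - 2))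
    {t : ℝ} (ht : t ∈ J) : wilczynski m B i t = 0 := by
  rw [Finset.mem_Icc] at hi
  rw [wilczynski, Finset.sum_eq_zero, mul_zero]
  intro j hj
  rw [Finset.mem_Icc] at hj
  rw [iteratedDeriv_eq_zero_of_isOpen hJ (hB _ (by lia)) _ ht, mul_zero]

/-- The `i`-th Wilczynski form is a nonzero multiple of `B_{2m-2-i}` plus derivatives of
coefficients of higher index, so the coefficients vanish one after the other. -/
lemma coeff_eq_zero_of_wilczynski {m : ℕ} {J : Set ℝ} (hJ : IsOpen J) {B : ℕ → ℝ → ℝ}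
    (hW : ∀ i ∈ Finset.Icc 1 (2 * m - 2), ∀ t ∈ J, wilczynski m B i t = 0) :
    ∀ i < 2 * m - 2, ∀ t ∈ J, B i t = 0 := by
  have key : ∀ i, 1 ≤ i → i ≤ 2 * m - 2 → ∀ t ∈ J, B (2 * m - 2 - i) t = 0 := by
    intro i
    induction i using Nat.strong_induction_on with
    | _ i ih =>
      intro h1 h2 t ht
      have h := hW i (Finset.mem_Icc.2 ⟨h1, h2⟩) t ht
      rw [wilczynski, Finset.sum_eq_single 1] at h
      · have h3 : 2 * m + 1 - (i + 3) = 2 * m - 2 - i := by lia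
        rw [h3] at h
        have p1 : ((i + 1)! : ℝ) ≠ 0 := by positivity
        have p2 : ((2 * i + 2)! : ℝ) ≠ 0 := by positivity
        have p3 : ((2 * i + 3 - 1)! : ℝ) ≠ 0 := by positivity
        have p4 : ((2 * m - 2 - i)! : ℝ) ≠ 0 := by positivity
        have p5 : ((i + 2 - 1)! : ℝ) ≠ 0 := by positivity
        simpa [p1, p2, p3, p4, p5] using h
      · intro j hj hj1
        rw [Finset.mem_Icc] at hj
        have h3 : 2 * m + j - (i + 3) = 2 * m - 2 - (i + 1 - j) := by lia
        rw [h3, iteratedDeriv_eq_zero_of_isOpen hJ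
          (ih (i + 1 - j) (by lia) (by lia) (by lia)) _ ht, mul_zero]
      · simp [h1]
  intro i hi t ht
  have := key (2 * m - 2 - i) (by lia) (by lia) t ht
  rwa [show 2 * m - 2 - (2 * m - 2 - i) = i by lia] at this

end Wilczynski

section Adapted

/-- The change of parameter `υ` is smooth and regular on the open set `J`, and the smooth nowhere
vanishing weight `w` satisfies `(w² υ')' = 0` there; the last condition is stated after division
by `w`. -/
structure IsAdapted (J : Set ℝ) (υ w : ℝ → ℝ) : Prop where
  isOpen : IsOpen J
  contDiffOn : ContDiffOn ℝ ∞ υ J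
  deriv_ne_zero : ∀ t ∈ J, deriv υ t ≠ 0
  contDiffOn_weight : ContDiffOn ℝ ∞ w J
  weight_ne_zero : ∀ t ∈ J, w t ≠ 0
  relation : ∀ t ∈ J, 2 * deriv w t * deriv υ t + w t * deriv (deriv υ) t = 0

/-- The potential into which `κ` is transformed by the change of parameter `υ` with weight `w`. -/
noncomputable def potential (υ w : ℝ → ℝ) (κ t : ℝ) : ℝ :=
  deriv (deriv w) t / w t + κ * deriv υ t ^ 2

/-- The weight is `|υ'|^(-1/2)`. -/
lemma IsReparametrization.exists_isAdapted {I J : Set ℝ} {υ : ℝ → ℝ}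
    (h : IsReparametrization I J υ) : ∃ w, IsAdapted J υ w := by
  have hs : ContDiffOn ℝ ∞ (deriv υ) J := h.contDiffOn.deriv_of_isOpen h.isOpen (by simp)
  have hpos : ∀ t ∈ J, 0 < deriv υ t ^ 2 := fun t ht => by
    have := h.deriv_ne_zero t ht; positivity
  have hw : ContDiffOn ℝ ∞ (fun t => (deriv υ t ^ 2) ^ (-(1 / 4) : ℝ)) J :=
    (hs.pow 2).rpow_const_of_ne fun t ht => (hpos t ht).ne'
  refine ⟨fun t => (deriv υ t ^ 2) ^ (-(1 / 4) : ℝ), h.isOpen, h.contDiffOn, h.deriv_ne_zero, hw,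
    fun t ht => (Real.rpow_pos_of_pos (hpos t ht) _).ne', fun t ht => ?_⟩
  set w : ℝ → ℝ := fun t => (deriv υ t ^ 2) ^ (-(1 / 4) : ℝ) with hwdef
  have hw0 : w t ≠ 0 := (Real.rpow_pos_of_pos (hpos t ht) _).ne'
  have hrel : ∀ x ∈ J, w x ^ 4 * deriv υ x ^ 2 = 1 := fun x hx => by
    simp only [hwdef]
    rw [← Real.rpow_natCast, ← Real.rpow_mul (hpos x hx).le]
    norm_num
    rw [Real.rpow_neg_one, inv_mul_cancel₀ (hpos x hx).ne']
  have d1 := ((hasDerivAt_of_contDiffOn h.isOpen hw ht).fun_pow 4).mul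
    ((hasDerivAt_of_contDiffOn h.isOpen hs ht).fun_pow 2)
  have d2 := d1.unique ((hasDerivAt_const t (1 : ℝ)).congr_of_eventuallyEq
    (Filter.eventually_of_mem (h.isOpen.mem_nhds ht) hrel))
  have hs0 := h.deriv_ne_zero t ht
  have hne : 2 * w t ^ 3 * deriv υ t ≠ 0 := by positivity
  apply mul_left_cancel₀ hne
  push_cast at d2
  rw [mul_zero, ← d2]
  ring

/-- Near zero, `υ' = 1/(1 - κ t²)` and `w = √(1 - κ t²)` give the potential zero. -/
lemma exists_projective_isAdapted (κ : ℝ) : ∃ J : Set ℝ, ∃ υ w : ℝ → ℝ, (0 : ℝ) ∈ J ∧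
    J.OrdConnected ∧ IsAdapted J υ w ∧ ∀ t ∈ J, potential υ w κ t = 0 := by
  set ε : ℝ := 1 / (2 * (1 + |κ|)) with hε
  have hε0 : 0 < ε := by positivity
  -- Cutting off the denominator makes the integrand continuous on the whole line.
  set f : ℝ → ℝ := fun x => 1 / max (1 - κ * x ^ 2) (1 / 2) with hf
  have hfc : Continuous f := by
    refine continuous_const.div (by fun_prop) fun x => ?_
    have : (1 / 2 : ℝ) ≤ max (1 - κ * x ^ 2) (1 / 2) := le_max_right _ _
    positivity
  set J := Set.Ioo (-ε) ε with hJ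
  have hJo : IsOpen J := isOpen_Ioo
  have hu : ∀ t ∈ J, 1 / 2 ≤ 1 - κ * t ^ 2 := fun t ht => by
    have h1 : t ^ 2 ≤ ε ^ 2 := sq_le_sq' ht.1.le ht.2.le
    have h2 : κ * t ^ 2 ≤ |κ| * ε ^ 2 := by
      have := le_abs_self κ
      have := abs_nonneg κ
      nlinarith [sq_nonneg t]
    have h3 : |κ| * ε ^ 2 ≤ 1 / 2 := by
      have := abs_nonneg κ
      rw [hε, div_pow, mul_div_assoc', div_le_div_iff₀ (by positivity) (by positivity)]
      nlinarith
    linarith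
  have hpos : ∀ t ∈ J, 0 < 1 - κ * t ^ 2 := fun t ht => by linarith [hu t ht]
  set υ : ℝ → ℝ := fun t => ∫ x in (0 : ℝ)..t, f x with hυ
  have hυd : ∀ t, HasDerivAt υ (f t) t := fun t => (hfc.integral_hasStrictDerivAt 0 t).hasDerivAt
  have hdυ : deriv υ = f := funext fun t => (hυd t).deriv
  have hfJ : ∀ t ∈ J, f t = (1 - κ * t ^ 2)⁻¹ := fun t ht => by
    simp only [hf]; rw [max_eq_left (hu t ht), one_div]
  have hud : ∀ t, HasDerivAt (fun x : ℝ => 1 - κ * x ^ 2) (-(2 * κ * t)) t := fun t => by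
    have := ((hasDerivAt_pow 2 t).const_mul κ).const_sub 1
    refine this.congr_deriv ?_
    push_cast
    ring
  have hus : ContDiffOn ℝ ∞ (fun x : ℝ => 1 - κ * x ^ 2) J := by fun_prop
  have hfs : ContDiffOn ℝ ∞ f J :=
    (hus.inv fun t ht => (hpos t ht).ne').congr hfJ
  set w : ℝ → ℝ := fun t => √(1 - κ * t ^ 2) with hw
  have hws : ContDiffOn ℝ ∞ w J := hus.sqrt fun t ht => (hpos t ht).ne'
  have hw0 : ∀ t ∈ J, 0 < w t := fun t ht => Real.sqrt_pos.2 (hpos t ht)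
  have hw2 : ∀ t ∈ J, w t ^ 2 = 1 - κ * t ^ 2 := fun t ht => Real.sq_sqrt (hpos t ht).le
  have hwd : ∀ t ∈ J, HasDerivAt w (-(κ * t) / w t) t := fun t ht => by
    have := (hud t).sqrt (hpos t ht).ne'
    refine this.congr_deriv ?_
    have := (hw0 t ht).ne'
    simp only [hw] at this ⊢
    field_simp
  have hfd : ∀ t ∈ J, HasDerivAt f (2 * κ * t / (1 - κ * t ^ 2) ^ 2) t := fun t ht => by
    have := ((hud t).fun_inv (hpos t ht).ne').congr_of_eventuallyEq
      (Filter.eventually_of_mem (hJo.mem_nhds ht) hfJ)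
    refine this.congr_deriv ?_
    ring
  have hwdd : ∀ t ∈ J, HasDerivAt (deriv w) (-κ / w t ^ 3) t := fun t ht => by
    have h1 : HasDerivAt (fun x => -(κ * x) / w x) _ t :=
      (((hasDerivAt_id t).const_mul κ).fun_neg).fun_div (hwd t ht) (hw0 t ht).ne'
    have h2 := h1.congr_of_eventuallyEq
      (Filter.eventually_of_mem (hJo.mem_nhds ht) fun x hx => (hwd x hx).deriv)
    refine h2.congr_deriv ?_
    have := (hw0 t ht).ne'
    have h3 := hw2 t ht
    simp only [id]
    field_simp
    linear_combination (-κ) * h3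
  refine ⟨J, υ, w, ⟨by linarith, hε0⟩, Set.ordConnected_Ioo, ⟨hJo, ?_, ?_, hws,
    fun t ht => (hw0 t ht).ne', ?_⟩, ?_⟩
  · rw [contDiffOn_infty_iff_deriv_of_isOpen hJo, hdυ]
    exact ⟨fun t _ => (hυd t).differentiableAt.differentiableWithinAt, hfs⟩
  · intro t ht
    rw [hdυ, hfJ t ht]
    exact inv_ne_zero (hpos t ht).ne'
  · intro t ht
    rw [hdυ, (hfd t ht).deriv, (hwd t ht).deriv, hfJ t ht, ← hw2 t ht]
    have := (hw0 t ht).ne'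
    field_simp
    ring
  · intro t ht
    rw [potential, hdυ, (hwdd t ht).deriv, hfJ t ht, ← hw2 t ht]
    have := (hw0 t ht).ne'
    field_simp
    ring

end Adapted

variable {V : Type*} [NormedAddCommGroup V] [NormedSpace ℝ V]

section Curve

variable {Λ : ℝ → Projectivization ℝ V} {J : Set ℝ} {E : ℝ → V} {υ w : ℝ → ℝ}

/-- Two lifts of the same curve differ by a smooth scalar function: it is a quotient of the values
of a linear functional. -/
lemma IsLift.exists_eq_smul (hJ : IsOpen J) {E₁ E₂ : ℝ → V} (h₁ : IsLift Λ J E₁)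
    (h₂ : IsLift Λ J E₂) :
    ∃ g : ℝ → ℝ, ContDiffOn ℝ ∞ g J ∧ ∀ t ∈ J, E₁ t = g t • E₂ t := by
  have h : ∀ t ∈ J, ∃ c : ℝ, E₁ t = c • E₂ t := fun t ht => by
    have m₁ := h₁.mem t ht
    have m₂ := h₂.mem t ht
    rw [Projectivization.submodule_eq] at m₁ m₂
    obtain ⟨a, ha⟩ := Submodule.mem_span_singleton.1 m₁
    obtain ⟨b, hb⟩ := Submodule.mem_span_singleton.1 m₂
    have hb0 : b ≠ 0 := by
      rintro rfl
      exact h₂.ne_zero t ht (by rw [← hb, zero_smul])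
    exact ⟨a / b, by rw [← ha, ← hb, smul_smul, div_mul_cancel₀ _ hb0]⟩
  choose! g hg using h
  refine ⟨g, fun t ht => ContDiffAt.contDiffWithinAt ?_, hg⟩
  obtain ⟨ℓ, hℓ⟩ := SeparatingDual.exists_ne_zero (R := ℝ) (h₂.ne_zero t ht)
  have c₁ : ContDiffAt ℝ ∞ (fun x => ℓ (E₁ x)) t :=
    ℓ.contDiff.contDiffAt.comp t (h₁.contDiffOn.contDiffAt (hJ.mem_nhds ht))
  have c₂ : ContDiffAt ℝ ∞ (fun x => ℓ (E₂ x)) t :=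
    ℓ.contDiff.contDiffAt.comp t (h₂.contDiffOn.contDiffAt (hJ.mem_nhds ht))
  refine (c₁.div c₂ hℓ).congr_of_eventuallyEq ?_
  filter_upwards [hJ.mem_nhds ht, c₂.continuousAt.eventually_ne hℓ] with x hx hx'
  simp only [Pi.div_apply]
  rw [hg x hx, map_smul, smul_eq_mul, mul_div_cancel_right₀ _ hx']

lemma IsRegularCurve.initialSpan_eq_top {m : ℕ} (hm : 1 ≤ m) (hreg : IsRegularCurve m Λ Set.univ)
    (hE : IsLift Λ Set.univ E) (t : ℝ) :
    initialSpan (fun i => iteratedDeriv i E t) (2 * m) = ⊤ := by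
  rw [← hreg.span_eq_top E hE t (Set.mem_univ t), osculatingSpace, initialSpan]
  congr 1
  ext x
  constructor
  · rintro ⟨i, hi, rfl⟩
    exact ⟨⟨i, by rw [Set.mem_Iio] at hi; lia⟩, rfl⟩
  · rintro ⟨i, rfl⟩
    exact ⟨i, by rw [Set.mem_Iio]; lia, rfl⟩

lemma IsLift.contDiff (hE : IsLift Λ Set.univ E) : ContDiff ℝ ∞ E :=
  contDiffOn_univ.1 hE.contDiffOn

/-- The lift `w^N E ∘ υ` of the reparametrized curve `Λ ∘ υ`. -/
noncomputable def adaptedLift (N : ℕ) (E : ℝ → V) (υ w : ℝ → ℝ) (t : ℝ) : V := w t ^ N • E (υ t)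

lemma IsAdapted.isLift (h : IsAdapted J υ w) (hE : IsLift Λ Set.univ E) (N : ℕ) :
    IsLift (Λ ∘ υ) J (adaptedLift N E υ w) where
  contDiffOn := (h.contDiffOn_weight.pow N).smul (hE.contDiff.comp_contDiffOn h.contDiffOn)
  ne_zero t ht := smul_ne_zero (pow_ne_zero _ (h.weight_ne_zero t ht)) (hE.ne_zero _ trivial)
  mem t _ := Submodule.smul_mem _ _ (hE.mem (υ t) trivial)

lemma IsAdapted.initialSpan_eq (h : IsAdapted J υ w) (hE : IsLift Λ Set.univ E) (N k : ℕ) {t : ℝ}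
    (ht : t ∈ J) :
    initialSpan (fun i => iteratedDeriv i (adaptedLift N E υ w) t) k =
      initialSpan (fun i => iteratedDeriv i E (υ t)) k := by
  refine initialSpan_eq_of_triangular (fun k => w t ^ N * deriv υ t ^ k)
    (fun k => mul_ne_zero (pow_ne_zero _ (h.weight_ne_zero t ht))
      (pow_ne_zero _ (h.deriv_ne_zero t ht))) (fun k => ?_) k
  refine (smoothComb_iteratedDeriv_sub h.isOpen (v := fun i t => iteratedDeriv i E (υ t))
    (f := fun t => w t ^ N) (h.contDiffOn.deriv_of_isOpen h.isOpen (by simp))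
    (h.contDiffOn_weight.pow N) (h.isLift hE N).contDiffOn (fun i x hx => ?_)
    (fun x _ => by simp [adaptedLift]) k).mem_initialSpan ht
  exact (hasDerivAt_iteratedDeriv isOpen_univ hE.contDiffOn i trivial).scomp x
    (hasDerivAt_of_contDiffOn h.isOpen h.contDiffOn hx)

lemma IsAdapted.exists_chain (h : IsAdapted J υ w) (hE : IsLift Λ Set.univ E) (N : ℕ) (κ : ℝ) :
    ∃ T : ℕ → ℝ → V, IsKacChain J N (fun _ => 1) (potential υ w κ) T ∧
      (∀ t ∈ J, adaptedLift N E υ w t = T 0 t) ∧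
      ∀ t, T (N + 1) t = (w t ^ N * deriv υ t ^ (N + 1)) •
        evalAt (fun i => iteratedDeriv i E (υ t)) (sylvesterKac N κ (N + 1)) := by
  have hs : ContDiffOn ℝ ∞ (deriv υ) J := h.contDiffOn.deriv_of_isOpen h.isOpen (by simp)
  have ha : ContDiffOn ℝ ∞ (deriv w) J := h.contDiffOn_weight.deriv_of_isOpen h.isOpen (by simp)
  obtain ⟨T, hT, hT0, hTN⟩ := (isKacChain_evalAt (J := J) (N := N) hE.contDiff κ
    fun t ht => hasDerivAt_of_contDiffOn h.isOpen h.contDiffOn ht).reparam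
    (fun t ht => hasDerivAt_of_contDiffOn h.isOpen h.contDiffOn_weight ht)
    (fun t ht => hasDerivAt_of_contDiffOn h.isOpen ha ht)
    (fun t ht => hasDerivAt_of_contDiffOn h.isOpen hs ht) h.weight_ne_zero h.relation
  refine ⟨T, hT, fun t _ => ?_, hTN⟩
  have h0 := evalAt_X_pow (fun i => iteratedDeriv i E (υ t)) 0
  rw [pow_zero] at h0
  rw [hT0, adaptedLift, sylvesterKac, h0, iteratedDeriv_zero]

lemma contDiffOn_potential (h : IsAdapted J υ w) (κ : ℝ) :
    ContDiffOn ℝ ∞ (potential υ w κ) J := by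
  have hs : ContDiffOn ℝ ∞ (deriv υ) J := h.contDiffOn.deriv_of_isOpen h.isOpen (by simp)
  have ha : ContDiffOn ℝ ∞ (deriv w) J := h.contDiffOn_weight.deriv_of_isOpen h.isOpen (by simp)
  exact ((ha.deriv_of_isOpen h.isOpen (by simp)).div h.contDiffOn_weight h.weight_ne_zero).add
    (contDiffOn_const.mul (hs.pow 2))

/-- For constant curvatures, the equation of a strongly canonical section has constant coefficients
and the characteristic polynomial `realCharPoly m r`. -/
lemma HasSymplecticCurvatures.exists_evalAt_eq_zero {m : ℕ} {σ : LinearMap.BilinForm ℝ V}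
    {r : Fin m → ℝ} (h : HasSymplecticCurvatures m σ Λ Set.univ (fun k _ => r k)) :
    ∃ E, IsLift Λ Set.univ E ∧
      ∀ t, evalAt (fun i => iteratedDeriv i E t) (realCharPoly m r) = 0 := by
  obtain ⟨-, E, ⟨⟨B, hB⟩, -⟩, hE⟩ := h
  refine ⟨E, hB.isLift, fun t => ?_⟩
  rw [realCharPoly, map_add, evalAt_X_pow, map_sum, hE t trivial, ← Finset.sum_add_distrib]
  refine Finset.sum_eq_zero fun k _ => ?_
  set p := m - ((k : ℕ) + 1) with hp
  have h1 : iteratedDeriv p (fun s => r k • iteratedDeriv p E s) t =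
      r k • iteratedDeriv (2 * p) E t := by
    rw [iteratedDeriv_fun_const_smul_field]
    rw [iteratedDeriv_eq_iterate, iteratedDeriv_eq_iterate, iteratedDeriv_eq_iterate,
      ← Function.iterate_add_apply, two_mul]
  rw [h1, evalAt_C_mul_X_pow, pow_add, pow_add]
  module

end Curve

end

/-! ### The two implications -/

section

lemma coeff_realCharPoly_sub_sylvesterKac {m : ℕ} (hm : 1 ≤ m) (r : Fin m → ℝ) (j : ℕ)
    (hj : 2 * m - 2 ≤ j) :
    (realCharPoly m r - sylvesterKac (2 * m - 1) (projectiveConst m hm r) (2 * m)).coeff j = 0 := by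
  rw [coeff_sub]
  obtain ⟨M, hM⟩ : ∃ M, 2 * m = M + 2 := ⟨2 * m - 2, by lia⟩
  have h1 : 2 * m - 1 = M + 1 := by lia
  have h2 : 2 * m - 2 = M := by lia
  rcases (by lia : j = 2 * m - 2 ∨ j = 2 * m - 1 ∨ j = 2 * m ∨ 2 * m < j) with
    rfl | rfl | rfl | hj'
  · have hc := (sylvesterKacConst_pos (N := M + 1) (by lia)).ne'
    rw [coeff_realCharPoly_sub_two m r hm, projectiveConst, h2, h1, hM,
      coeff_sylvesterKac_add_two, mul_div_cancel₀ _ hc, sub_self]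
  · rw [coeff_realCharPoly_sub_one m r hm, h1, hM, coeff_sylvesterKac_succ, sub_self]
  · rw [coeff_realCharPoly_top, coeff_sylvesterKac_self, sub_self]
  · rw [coeff_realCharPoly_of_lt m r hj', coeff_sylvesterKac_of_lt _ _ _ _ hj', sub_self]

variable {V : Type*} [NormedAddCommGroup V] [NormedSpace ℝ V] {Λ : ℝ → Projectivization ℝ V}
  {E : ℝ → V} {m : ℕ} {r : Fin m → ℝ}

theorem isExceptional_of_allWilczynskiInvariantsZero (hm : 1 ≤ m)
    (hind : ∀ t, LinearIndependent ℝ fun i : Fin (2 * m) => iteratedDeriv i E t)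
    (hE : IsLift Λ Set.univ E)
    (hode : ∀ t, evalAt (fun i => iteratedDeriv i E t) (realCharPoly m r) = 0)
    (hW : AllWilczynskiInvariantsZero m Λ Set.univ) : IsExceptional m r := by
  rw [isExceptional_iff hm]
  set κ := projectiveConst m hm r
  set N := 2 * m - 1 with hN
  have hN1 : N + 1 = 2 * m := by lia
  set R := realCharPoly m r - sylvesterKac N κ (2 * m) with hR
  have hR0 : ∀ j, 2 * m - 2 ≤ j → R.coeff j = 0 := coeff_realCharPoly_sub_sylvesterKac hm r
  have hKR (t : ℝ) : evalAt (fun i => iteratedDeriv i E t) (sylvesterKac N κ (2 * m)) =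
      -evalAt (fun i => iteratedDeriv i E t) R := by
    rw [hR, map_sub, hode, zero_sub, neg_neg]
  obtain ⟨J, υ, w, h0J, hJc, h, hpot⟩ := exists_projective_isAdapted κ
  obtain ⟨T, hT, hT0, hTN⟩ := h.exists_chain hE N κ
  set F := adaptedLift N E υ w with hF
  have hFn : ∀ t ∈ J, iteratedDeriv (2 * m) F t = (w t ^ N * deriv υ t ^ (N + 1)) •
      -evalAt (fun i => iteratedDeriv i E (υ t)) R := fun t ht => by
    rw [← hKR, ← hN1, hT.iteratedDeriv_eq h.isOpen hpot hT0 (N + 1) le_rfl t ht, hTN]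
  have hmem : ∀ t ∈ J, ∃ b : ℕ → ℝ, iteratedDeriv (2 * m) F t =
      ∑ i ∈ Finset.range (2 * m - 2), b i • iteratedDeriv i F t := fun t ht => by
    refine exists_sum_range_of_mem_initialSpan (v := fun i => iteratedDeriv i F t) ?_
    rw [h.initialSpan_eq hE N _ ht, hFn t ht, evalAt_eq_sum_range _ hR0]
    exact Submodule.smul_mem _ _ (Submodule.neg_mem _
      (sum_range_mem_initialSpan (fun i => iteratedDeriv i E (υ t)) _ _))
  choose! b hb using hmem
  -- `F^(2m)` involves only derivatives of order less than `2m - 2`: the parameter is projective.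
  have hproj : IsProjectiveParameter m Λ Set.univ J υ F
      (fun i t => if i < 2 * m - 2 then b t i else 0) := by
    refine ⟨⟨h.isOpen, hJc, fun _ _ => trivial, h.contDiffOn, h.deriv_ne_zero⟩,
      ⟨h.isLift hE N, fun t ht => ?_⟩, fun t _ => by simp⟩
    rw [show 2 * m - 1 = 2 * m - 2 + 1 by lia, Finset.sum_range_succ, hb t ht]
    simp only [lt_irrefl, if_false, zero_smul, add_zero]
    exact Finset.sum_congr rfl fun i hi => by rw [if_pos (Finset.mem_range.1 hi)]
  have hB := coeff_eq_zero_of_wilczynski h.isOpen (hW J υ F _ hproj)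
  have hFn0 : iteratedDeriv (2 * m) F 0 = 0 := by
    rw [hb 0 h0J]
    refine Finset.sum_eq_zero fun i hi => ?_
    have hi' := Finset.mem_range.1 hi
    have := hB i hi' 0 h0J
    rw [if_pos hi'] at this
    rw [this, zero_smul]
  rw [hFn 0 h0J, smul_eq_zero_iff_right (mul_ne_zero (pow_ne_zero _ (h.weight_ne_zero 0 h0J))
    (pow_ne_zero _ (h.deriv_ne_zero 0 h0J))), neg_eq_zero, evalAt_eq_sum_range _ hR0] at hFn0
  have hRz : R = 0 := by
    ext j
    rcases lt_or_ge j (2 * m - 2) with hj | hj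
    · exact coeff_eq_zero_of_sum_range_eq_zero (hind (υ 0)) (by lia) hFn0 j hj
    · exact hR0 j hj
  exact sub_eq_zero.1 hRz

theorem allWilczynskiInvariantsZero_of_isExceptional (hm : 1 ≤ m)
    (hV : Module.finrank ℝ V = 2 * m)
    (hspan : ∀ t, initialSpan (fun i => iteratedDeriv i E t) (2 * m) = ⊤)
    (hE : IsLift Λ Set.univ E)
    (hode : ∀ t, evalAt (fun i => iteratedDeriv i E t) (realCharPoly m r) = 0)
    (hr : IsExceptional m r) : AllWilczynskiInvariantsZero m Λ Set.univ := by
  rw [isExceptional_iff hm] at hr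
  set κ := projectiveConst m hm r
  set N := 2 * m - 1 with hN
  have hN1 : N + 1 = 2 * m := by lia
  rintro J υ G B ⟨hrep, hG, hB0⟩ i hi t₀ ht₀
  have hJ := hrep.isOpen
  obtain ⟨w, h⟩ := hrep.exists_isAdapted
  obtain ⟨T, hT, hT0, hTN⟩ := h.exists_chain hE N κ
  have hFl := h.isLift hE N
  set F := adaptedLift N E υ w with hF
  have hTN0 (t : ℝ) : T (2 * m) t = 0 := by
    rw [← hN1, hTN, hN1, ← hr, hode, smul_zero]
  have hind : ∀ t ∈ J, LinearIndependent ℝ fun i : Fin (2 * m) => iteratedDeriv i F t :=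
    fun t ht => linearIndependent_of_initialSpan_eq_top (v := fun i => iteratedDeriv i F t)
      (by lia) hV (by rw [h.initialSpan_eq hE N _ ht, hspan])
  have hq := contDiffOn_potential h κ
  have hcomb := hT.smoothComb_iteratedDeriv hJ hq hFl.contDiffOn hT0 (2 * m - 2) (by lia)
  rw [show 2 * m - 2 + 2 = 2 * m by lia] at hcomb
  have hFn : ∀ t ∈ J, iteratedDeriv (2 * m) F t -
      (sylvesterKacConst ℝ N (2 * m) * potential υ w κ t) • iteratedDeriv (2 * m - 2) F t ∈
        initialSpan (fun i => iteratedDeriv i F t) (2 * m - 2) := fun t ht => by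
    have := hcomb.mem_initialSpan ht
    rwa [hTN0, sub_zero] at this
  obtain ⟨g, hg, hGF⟩ := hG.isLift.exists_eq_smul hJ hFl
  have hspanG : ∀ t ∈ J, ∀ k < 2 * m - 1, iteratedDeriv k G t ∈
      initialSpan (fun i => iteratedDeriv i F t) (2 * m - 1) := fun t ht k hk => by
    have h1 := (smoothComb_iteratedDeriv_sub hJ (v := fun i => iteratedDeriv i F)
      (s := fun _ => 1) contDiffOn_const hg hG.isLift.contDiffOn
      (fun i x hx => by
        rw [one_smul]; exact hasDerivAt_iteratedDeriv hJ hFl.contDiffOn i hx)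
      (by simpa using hGF) k).mem_initialSpan ht
    rw [← sub_add_cancel (iteratedDeriv k G t) ((g t * 1 ^ k) • iteratedDeriv k F t)]
    exact Submodule.add_mem _ (initialSpan_mono _ hk.le h1)
      (Submodule.smul_mem _ _ (mem_initialSpan (v := fun i => iteratedDeriv i F t) hk))
  have hFn' : ∀ t ∈ J, iteratedDeriv (2 * m) F t ∈
      initialSpan (fun i => iteratedDeriv i F t) (2 * m - 1) := fun t ht => by
    have := Submodule.add_mem _ (initialSpan_mono _ (by lia : 2 * m - 2 ≤ 2 * m - 1) (hFn t ht))
      (Submodule.smul_mem _ (sylvesterKacConst ℝ N (2 * m) * potential υ w κ t)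
        (mem_initialSpan (v := fun i => iteratedDeriv i F t) (by lia : 2 * m - 2 < 2 * m - 1)))
    simpa using this
  -- Neither `F^(2m)` nor `G^(2m)` has a term of order `2m - 1`, whereas `(g F)^(2m)` contains
  -- `2m g' F^(2m-1)`.
  have hg0 : ∀ t ∈ J, HasDerivAt g 0 t := fun t ht => by
    have h1 := (smoothComb_iteratedDeriv_smul hJ hFl.contDiffOn hg hG.isLift.contDiffOn hGF
      (2 * m - 1)).mem_initialSpan ht
    rw [show 2 * m - 1 + 1 = 2 * m by lia] at h1
    have h2 : iteratedDeriv (2 * m) G t ∈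
        initialSpan (fun i => iteratedDeriv i F t) (2 * m - 1) := by
      rw [hG.expansion t ht]
      exact Submodule.sum_mem _ fun i hi =>
        Submodule.smul_mem _ _ (hspanG t ht i (Finset.mem_range.1 hi))
    have h3 := Submodule.sub_mem _ (Submodule.sub_mem _ h2
      (Submodule.smul_mem _ (g t) (hFn' t ht))) h1
    rw [sub_sub_cancel] at h3
    have h4 := eq_zero_of_smul_mem_initialSpan (v := fun i => iteratedDeriv i F t) (hind t ht)
      (by lia) h3
    have h5 : ((2 * m - 1 : ℕ) : ℝ) + 1 ≠ 0 := by positivity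
    have h6 : deriv g t = 0 := (mul_eq_zero.1 h4).resolve_left h5
    rw [← h6]
    exact hasDerivAt_of_contDiffOn hJ hg ht
  have hgne : ∀ t ∈ J, g t ≠ 0 := fun t ht h0 =>
    hG.isLift.ne_zero t ht (by rw [hGF t ht, h0, zero_smul])
  have hFB : ∀ t ∈ J, iteratedDeriv (2 * m) F t =
      ∑ i ∈ Finset.range (2 * m - 1), B i t • iteratedDeriv i F t := fun t ht => by
    have h1 := hG.expansion t ht
    have h2 := iteratedDeriv_smul_of_deriv_eq_zero hJ hFl.contDiffOn hg0 hGF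
    simp only [h2 _ t ht, smul_comm (B _ t) (g t), ← Finset.smul_sum] at h1
    exact smul_right_injective V (hgne t ht) h1
  -- As the parameter is projective, the term of order `2m - 2` of `F^(2m)` vanishes.
  have hpot : ∀ t ∈ J, potential υ w κ t = 0 := fun t ht => by
    have h1 : iteratedDeriv (2 * m) F t ∈
        initialSpan (fun i => iteratedDeriv i F t) (2 * m - 2) := by
      rw [hFB t ht, show 2 * m - 1 = 2 * m - 2 + 1 by lia, Finset.sum_range_succ, hB0 t ht,
        zero_smul, add_zero]
      exact sum_range_mem_initialSpan (fun i => iteratedDeriv i F t) _ fun i => B i t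
    have h2 := Submodule.sub_mem _ h1 (hFn t ht)
    rw [sub_sub_cancel] at h2
    have h3 := eq_zero_of_smul_mem_initialSpan (v := fun i => iteratedDeriv i F t) (hind t ht)
      (by lia) h2
    have hc := (sylvesterKacConst_pos (N := N) (by lia)).ne'
    rw [hN1] at hc
    exact (mul_eq_zero.1 h3).resolve_left hc
  refine wilczynski_eq_zero hJ (fun j hj t ht => ?_) hi ht₀
  have h1 := hT.iteratedDeriv_eq hJ hpot hT0 (2 * m) hN1.ge t ht
  rw [hTN0, hFB t ht] at h1
  exact coeff_eq_zero_of_sum_range_eq_zero (v := fun i => iteratedDeriv i F t)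
    (a := fun i => B i t) (hind t ht) (by lia) h1 j (by lia)

end

end SelfDualCurve


theorem proposition1 {V : Type*} [NormedAddCommGroup V] [NormedSpace ℝ V] (m : ℕ) (hm : 1 ≤ m)
    (hV : Module.finrank ℝ V = 2 * m) (σ : LinearMap.BilinForm ℝ V) (hσ : σ.IsAlt)
    (hσ' : σ.Nondegenerate) (r : Fin m → ℝ) (Λ : ℝ → Projectivization ℝ V)
    (hreg : SelfDualCurve.IsRegularCurve m Λ Set.univ)
    (hsd : SelfDualCurve.IsSelfDualCurve m σ Λ Set.univ)
    (hcurv : SelfDualCurve.HasSymplecticCurvatures m σ Λ Set.univ (fun k _ => r k)) :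
    SelfDualCurve.AllWilczynskiInvariantsZero m Λ Set.univ ↔
      SelfDualCurve.IsExceptional m r := by
  obtain ⟨E, hE, hode⟩ := hcurv.exists_evalAt_eq_zero
  have hspan := hreg.initialSpan_eq_top hm hE
  exact ⟨SelfDualCurve.isExceptional_of_allWilczynskiInvariantsZero hm
      (fun t => SelfDualCurve.linearIndependent_of_initialSpan_eq_top
        (v := fun i => iteratedDeriv i E t) (by lia) hV (hspan t)) hE hode,
    SelfDualCurve.allWilczynskiInvariantsZero_of_isExceptional hm hV hspan hE hode⟩
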